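/- **Setting.** In $L^2(0,\pi)$ let $L_0y=-y''$ with domain $\{y\in W_2^2(0,\pi):\ y(0)=y(\pi),\ y'(0)=y'(\pi)\}$, and for $\alpha\in\mathbb R$, $v\in L^2(0,\pi)$ let $L(\alpha,v)=L_0+\alpha\langle\cdot,v\rangle v$ with the same domain. Spectra $\sigma(\cdot)$ are counted with multiplicity: $\sigma(\cdot)$ is the set of points of the spectrum, each taken together with the dimension of its eigenspace. ($\sigma(L_0)=\{4k^2:k\ge 0\}$, where $0$ has multiplicity $1$ and the other points have multiplicity $2$.) Put $$c_0(v)=\Big\langle v,\tfrac1{\sqrt\pi}\Big\rangle,\qquad c_k(v)=\Big\langle v,\sqrt{\tfrac2\pi}\cos 2kx\Big\rangle\ (k\ge1),\qquad s_k(v)=\Big\langle v,\sqrt{\tfrac2\pi}\sin 2kx\Big\rangle,$$ and let $v_k$ be the orthogonal projection of $v$ onto the eigenspace $G_k$ of $L_0$ for the eigenvalue $4k^2$, i.e. $G_0=\operatorname{span}\{1\}$, $G_k=\operatorname{span}\{\cos 2kx,\sin 2kx\}$. Let $$w(x)=v(x)+x-\tfrac\pi2,\qquad \widehat w(x)=v(x)+\big(x-\tfrac\pi2\big)^2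 .$$ For a spectrum $S$ counted with multiplicity, let $M(S)$ and $Z(S)$ be the sets of real numbers whose multiplicity in $S$ is respectively larger and smaller than in $\sigma(L_0)$. Put $\phi_a(z)=1-z/a$ for $a\ne0$ and $\phi_0(z)=z$. **Theorem 4.2 (with Remark 4.2).** Let $\alpha\in\mathbb R$ and let $v\in L^2(0,\pi)$ be real. 1. For each $u\in\{v,w,\widehat w\}$ the numbers $\alpha\|u_p\|^2$ are computed from $S=\sigma(L(\alpha,u))$: with $M=M(S)$ and $Z=Z(S)$ the products below converge unconditionally, there is $A\neq0$ with $$\frac1A=\lim_{y\to+\infty}\frac{\prod_{\mu\in M}\phi_\mu(iy)}{\prod_{a\in Z}\phi_a(iy)},$$ and, for every integer $p\ge0$, $$\alpha\|u_p\|^2=A\,\kappa_p\,\frac{\prod_{\mu\in M}\phi_\mu(4p^2)}{\prod_{a\in Z,\ a\ne4p^2}\phi_a(4p^2)}\ \text{ if } 4p^2\in Z,\qquad \alpha\|u_p\|^2=0\ \text{ if } 4p^2\notin Z,$$ where $\kappa_0=-1$ and $\kappa_p=4p^2$ for $p\ge1$. 2. For $k\ge1$, $$\alpha s_k(v)=\frac{k}{\sqrt{2\pi}}\Big\{\alpha\|v_k\|^2-\alpha\|w_k\|^2+\frac{\alpha\pi}{2k^2}\Big\},\qquad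 \alpha c_k(v)=\frac{k^2}{\sqrt{2\pi}}\Big\{\alpha\|\widehat w_k\|^2-\alpha\|v_k\|^2-\frac{\alpha\pi}{2k^4}\Big\},$$ and $$\alpha c_0(v)=\frac{6}{\pi^{5/2}}\Big\{\alpha\|\widehat w_0\|^2-\alpha\|v_0\|^2-\frac{\alpha\pi^5}{144}\Big\}.$$ 3. If $\|v\|=1$, then $\alpha=\sum_{p\ge0}\alpha\|v_p\|^2$ and $\alpha^2=\sum_{k\ge0}\big((\alpha c_k(v))^2+(\alpha s_k(v))^2\big)$. 4. If $\alpha\neq0$ and $v\ne0$, then, with $S=\sigma(L(\alpha,v))$: $\alpha>0$ if and only if some point of $Z(S)$ is smaller than all points of $M(S)$, and $\alpha<0$ if and only if some point of $M(S)$ is smaller than all points of $Z(S)$. 5. (Uniqueness.) Let $\alpha'\in\mathbb R$, let $v'\in L^2(0,\pi)$ be real, and let $w',\widehat w'$ be formed from $v'$ as $w,\widehat w$ are from $v$. Suppose that the two pairs are normalized in the same way: either $\|v\|=\|v'\|=1$, or $\alpha,\alpha'\in\{1,-1\}$. If $$\sigma(L(\alpha,v))=\sigma(L(\alpha',v')),\quad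 \sigma(L(\alpha,w))=\sigma(L(\alpha',w')),\quad \sigma(L(\alpha,\widehat w))=\sigma(L(\alpha',\widehat w')),$$ then $\alpha s_k(v)=\alpha's_k(v')$ and $\alpha c_k(v)=\alpha'c_k(v')$ for all $k\ge 0$, and $\alpha=\alpha'$; if moreover $\alpha\ne0$, then $v=v'$. -/

import Mathlib

open MeasureTheory Filter Topology

noncomputable section

namespace NonlocalPeriodic

/-- Lebesgue measure on the interval `(0, π)` (the endpoint `π` is a null set). -/
abbrev mu : Measure ℝ := volume.restrict (Set.Ioc 0 Real.pi)

/-- The complex Hilbert space `L²(0, π)`. -/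
abbrev H : Type := Lp ℂ 2 mu

/-- `y` belongs to the Sobolev space `W₂²(0, π)`: it has a representative `Y` which is a primitive
of `Y₁` on `[0, π]`, where `Y₁` is absolutely continuous with derivative `y₂ ∈ L²(0, π)`. -/
def IsW22 (y : H) (Y Y₁ : ℝ → ℂ) (y₂ : H) : Prop :=
  (y : ℝ → ℂ) =ᵐ[mu] Y ∧
  (∀ x ∈ Set.Icc 0 Real.pi, Y x = Y 0 + ∫ t in (0 : ℝ)..x, Y₁ t) ∧
  (∀ x ∈ Set.Icc 0 Real.pi, Y₁ x = Y₁ 0 + ∫ t in (0 : ℝ)..x, y₂ t)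

theorem intervalIntegrable_coe (f : H) {x : ℝ} (hx : x ∈ Set.Icc 0 Real.pi) :
    IntervalIntegrable (f : ℝ → ℂ) volume 0 x := by
  rw [intervalIntegrable_iff_integrableOn_Ioc_of_le hx.1]
  have h : Integrable (f : ℝ → ℂ) mu := (Lp.memLp f).integrable (by norm_num)
  exact IntegrableOn.mono_set (t := Set.Ioc 0 Real.pi) h (Set.Ioc_subset_Ioc_right hx.2)

theorem IsW22.continuousOn_deriv {y y₂ : H} {Y Y₁ : ℝ → ℂ} (h : IsW22 y Y Y₁ y₂) :
    ContinuousOn Y₁ (Set.Icc 0 Real.pi) := by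
  have h0 : IntegrableOn (y₂ : ℝ → ℂ) (Set.uIcc 0 Real.pi) volume := by
    rw [← intervalIntegrable_iff']
    exact intervalIntegrable_coe y₂ ⟨Real.pi_pos.le, le_rfl⟩
  have h1 := intervalIntegral.continuousOn_primitive_interval h0
  rw [Set.uIcc_of_le Real.pi_pos.le] at h1
  exact (continuousOn_const.add h1).congr fun x hx => h.2.2 x hx

theorem IsW22.intervalIntegrable {y y₂ : H} {Y Y₁ : ℝ → ℂ} (h : IsW22 y Y Y₁ y₂)
    {x : ℝ} (hx : x ∈ Set.Icc 0 Real.pi) : IntervalIntegrable Y₁ volume 0 x := by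
  refine ContinuousOn.intervalIntegrable (h.continuousOn_deriv.mono ?_)
  rw [Set.uIcc_of_le hx.1]
  exact Set.Icc_subset_Icc_right hx.2

theorem IsW22.continuousOn {y y₂ : H} {Y Y₁ : ℝ → ℂ} (h : IsW22 y Y Y₁ y₂) :
    ContinuousOn Y (Set.Icc 0 Real.pi) := by
  have h0 : IntegrableOn Y₁ (Set.uIcc 0 Real.pi) volume := by
    rw [← intervalIntegrable_iff']
    exact h.intervalIntegrable ⟨Real.pi_pos.le, le_rfl⟩
  have h1 := intervalIntegral.continuousOn_primitive_interval h0
  rw [Set.uIcc_of_le Real.pi_pos.le] at h1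
  exact (continuousOn_const.add h1).congr fun x hx => h.2.1 x hx

theorem ae_eq_zero_of_primitive {f : ℝ → ℂ} (hf : IntervalIntegrable f volume 0 Real.pi)
    (h : ∀ x ∈ Set.Icc 0 Real.pi, ∫ t in (0 : ℝ)..x, f t = 0) : f =ᵐ[mu] 0 := by
  have h1 := hf.ae_hasDerivAt_integral
  rw [Set.uIcc_of_le Real.pi_pos.le] at h1
  have h2 : ∀ᵐ x : ℝ, x ≠ Real.pi := by simp [ae_iff]
  refine (ae_restrict_iff' measurableSet_Ioc).2 ?_
  filter_upwards [h1, h2] with x hx hne hmem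
  have hd := hx ⟨hmem.1.le, hmem.2⟩ 0 ⟨le_rfl, Real.pi_pos.le⟩
  have hz : (fun y => ∫ t in (0 : ℝ)..y, f t) =ᶠ[𝓝 x] fun _ => 0 := by
    filter_upwards [Ioo_mem_nhds hmem.1 (lt_of_le_of_ne hmem.2 hne)] with y hy
    exact h y ⟨hy.1.le, hy.2.le⟩
  exact hd.unique ((hasDerivAt_const x (0 : ℂ)).congr_of_eventuallyEq hz)

theorem eq_zero_of_ae {Y : ℝ → ℂ} (hc : ContinuousOn Y (Set.Icc 0 Real.pi))
    (h : Y =ᵐ[mu] 0) : ∀ x ∈ Set.Icc 0 Real.pi, Y x = 0 := by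
  have h' : Y =ᵐ[volume.restrict (Set.Icc 0 Real.pi)] fun _ => 0 := by
    rw [← restrict_Ioc_eq_restrict_Icc]
    exact h
  exact Measure.eqOn_Icc_of_ae_eq volume Real.pi_pos.ne h' hc continuousOn_const

/-- The graph of the periodic operator `L₀ y = -y''` with domain
`{y ∈ W₂²(0, π) : y(0) = y(π), y'(0) = y'(π)}`. -/
def graphL0 : Submodule ℂ (H × H) where
  carrier := {p | ∃ Y Y₁ : ℝ → ℂ, IsW22 p.1 Y Y₁ (-p.2) ∧ Y 0 = Y Real.pi ∧ Y₁ 0 = Y₁ Real.pi}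
  zero_mem' := by
    refine ⟨0, 0, ⟨Lp.coeFn_zero _ _ _, ?_, ?_⟩, rfl, rfl⟩
    · intro x _
      simp
    · intro x hx
      have h0 : ∫ t in (0 : ℝ)..x, (-(0 : H × H).2 : H) t = ∫ t in (0 : ℝ)..x, (0 : ℂ) := by
        refine intervalIntegral.integral_congr_ae ?_
        have := (ae_restrict_iff' measurableSet_Ioc).1 (Lp.coeFn_zero ℂ 2 mu)
        filter_upwards [this] with t ht hm
        rw [Set.uIoc_of_le hx.1] at hm
        simpa using ht ⟨hm.1, hm.2.trans hx.2⟩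
      rw [h0]
      simp
  add_mem' := by
    rintro p q ⟨Y, Y₁, h, hb, hb₁⟩ ⟨Z, Z₁, k, kb, kb₁⟩
    refine ⟨Y + Z, Y₁ + Z₁, ⟨?_, ?_, ?_⟩, by simp [hb, kb], by simp [hb₁, kb₁]⟩
    · exact (Lp.coeFn_add p.1 q.1).trans (h.1.add k.1)
    · intro x hx
      simp only [Pi.add_apply]
      rw [intervalIntegral.integral_add (h.intervalIntegrable hx) (k.intervalIntegrable hx),
        h.2.1 x hx, k.2.1 x hx]
      ring
    · intro x hx
      have h0 : ∫ t in (0 : ℝ)..x, (-(p + q).2 : H) t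
          = ∫ t in (0 : ℝ)..x, ((-p.2 : H) t + (-q.2 : H) t) := by
        refine intervalIntegral.integral_congr_ae ?_
        have := (ae_restrict_iff' measurableSet_Ioc).1 (Lp.coeFn_add (-p.2) (-q.2))
        filter_upwards [this] with t ht hm
        rw [Set.uIoc_of_le hx.1] at hm
        rw [Prod.snd_add, neg_add]
        exact ht ⟨hm.1, hm.2.trans hx.2⟩
      rw [h0, intervalIntegral.integral_add (intervalIntegrable_coe _ hx)
        (intervalIntegrable_coe _ hx)]
      simp only [Pi.add_apply]
      rw [h.2.2 x hx, k.2.2 x hx]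
      ring
  smul_mem' := by
    rintro c p ⟨Y, Y₁, h, hb, hb₁⟩
    refine ⟨c • Y, c • Y₁, ⟨?_, ?_, ?_⟩, by simp [hb], by simp [hb₁]⟩
    · exact (Lp.coeFn_smul c p.1).trans (h.1.const_smul c)
    · intro x hx
      simp only [Pi.smul_apply, smul_eq_mul]
      rw [h.2.1 x hx, mul_add, intervalIntegral.integral_const_mul]
    · intro x hx
      have h0 : ∫ t in (0 : ℝ)..x, (-(c • p).2 : H) t
          = ∫ t in (0 : ℝ)..x, c • (-p.2 : H) t := by
        refine intervalIntegral.integral_congr_ae ?_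
        have := (ae_restrict_iff' measurableSet_Ioc).1 (Lp.coeFn_smul c (-p.2))
        filter_upwards [this] with t ht hm
        rw [Set.uIoc_of_le hx.1] at hm
        rw [Prod.smul_snd, ← smul_neg]
        exact ht ⟨hm.1, hm.2.trans hx.2⟩
      rw [h0]
      simp only [Pi.smul_apply, smul_eq_mul]
      rw [h.2.2 x hx, mul_add, intervalIntegral.integral_const_mul]

/-- The second derivative of a function of class `W₂²` is unique, so `graphL0` is the graph of an
operator. -/
theorem graphL0_singleValued (p : H × H) (hp : p ∈ graphL0) (h0 : p.1 = 0) : p.2 = 0 := by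
  obtain ⟨Y, Y₁, h, -, -⟩ := hp
  have hpi : Real.pi ∈ Set.Icc 0 Real.pi := ⟨Real.pi_pos.le, le_rfl⟩
  have hz : (0 : ℝ) ∈ Set.Icc 0 Real.pi := ⟨le_rfl, Real.pi_pos.le⟩
  have hY : ∀ x ∈ Set.Icc 0 Real.pi, Y x = 0 := by
    refine eq_zero_of_ae h.continuousOn ?_
    refine h.1.symm.trans ?_
    rw [h0]
    exact Lp.coeFn_zero _ _ _
  have hY₁ : ∀ x ∈ Set.Icc 0 Real.pi, Y₁ x = 0 := by
    refine eq_zero_of_ae h.continuousOn_deriv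
      (ae_eq_zero_of_primitive (h.intervalIntegrable hpi) fun x hx => ?_)
    have := h.2.1 x hx
    rw [hY x hx, hY 0 hz, zero_add] at this
    exact this.symm
  have h2 : ((-p.2 : H) : ℝ → ℂ) =ᵐ[mu] 0 := by
    refine ae_eq_zero_of_primitive (intervalIntegrable_coe _ hpi) fun x hx => ?_
    have := h.2.2 x hx
    rw [hY₁ x hx, hY₁ 0 hz, zero_add] at this
    exact this.symm
  have h3 : -p.2 = 0 := Lp.ext (h2.trans (Lp.coeFn_zero _ _ _).symm)
  simpa using h3

/-- The operator `L₀ y = -y''` in `L²(0, π)` with periodic boundary conditions. -/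
def L0 : H →ₗ.[ℂ] H := graphL0.toLinearPMap

theorem graph_L0 : L0.graph = graphL0 := Submodule.toLinearPMap_graph_eq _ graphL0_singleValued

/-- The operator `L(α, v) y = L₀ y + α ⟨y, v⟩ v` with the domain of `L₀`. Mathlib's inner product
is linear in its second argument, so `inner ℂ v y = ∫ y v̄`. -/
def L (α : ℝ) (v : H) : H →ₗ.[ℂ] H where
  domain := L0.domain
  toFun := L0.toFun +
    (α : ℂ) • (((innerSL ℂ v).smulRight v : H →L[ℂ] H) : H →ₗ[ℂ] H).comp L0.domain.subtype

/-- `z` is in the resolvent set of `T`: `T - z` has a bounded everywhere defined inverse. -/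
def IsResolventPoint (T : H →ₗ.[ℂ] H) (z : ℂ) : Prop :=
  ∃ R : H →L[ℂ] H,
    (∀ f : H, ∃ y : T.domain, (y : H) = R f ∧ T y - z • (y : H) = f) ∧
    (∀ y : T.domain, R (T y - z • (y : H)) = y)

/-- The spectrum of an operator in `L²(0, π)`. -/
def specSet (T : H →ₗ.[ℂ] H) : Set ℂ := {z | ¬ IsResolventPoint T z}

/-- The eigenspace `{y ∈ D(T) : T y = z y}`. -/
def eigenspace (T : H →ₗ.[ℂ] H) (z : ℂ) : Submodule ℂ T.domain :=
  LinearMap.ker (T.toFun - z • T.domain.subtype)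

/-- The spectrum of `T` together with the multiplicities of its points: the set of all pairs
`(z, n)`, where `z` is a point of the spectrum and `n` is the dimension of its eigenspace. -/
def countedSpectrum (T : H →ₗ.[ℂ] H) : Set (ℂ × ℕ) :=
  {p | p.1 ∈ specSet T ∧ p.2 = Module.finrank ℂ (eigenspace T p.1)}

theorem memLp_of_continuous (f : ℝ → ℂ) (hf : Continuous f) : MemLp f 2 mu := by
  obtain ⟨C, hC⟩ := (isCompact_Icc (a := (0 : ℝ)) (b := Real.pi)).exists_bound_of_continuousOn
    hf.continuousOn
  refine MemLp.of_bound hf.aestronglyMeasurable C ?_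
  refine (ae_restrict_iff' measurableSet_Ioc).2 (Eventually.of_forall fun x hx => ?_)
  exact hC x ⟨hx.1.le, hx.2⟩

/-- A continuous function as an element of `L²(0, π)`. -/
def ofContinuous (f : ℝ → ℂ) (hf : Continuous f) : H := (memLp_of_continuous f hf).toLp f

/-- `√(2/π) cos 2kx` for `k ≥ 1`, and `1/√π` for `k = 0`. -/
def cosVec (k : ℕ) : H :=
  ofContinuous (fun x => ((if k = 0 then 1 / √Real.pi
    else √(2 / Real.pi) * Real.cos (2 * k * x) : ℝ) : ℂ))
    (Complex.continuous_ofReal.comp (by split_ifs <;> fun_prop))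

/-- `√(2/π) sin 2kx` (which is zero for `k = 0`). -/
def sinVec (k : ℕ) : H :=
  ofContinuous (fun x => ((√(2 / Real.pi) * Real.sin (2 * k * x) : ℝ) : ℂ)) (by fun_prop)

/-- The Fourier coefficient `c_k(v) = ⟨v, √(2/π) cos 2kx⟩` (`⟨v, 1/√π⟩` for `k = 0`). -/
def c (k : ℕ) (v : H) : ℂ := inner ℂ (cosVec k) v

/-- The Fourier coefficient `s_k(v) = ⟨v, √(2/π) sin 2kx⟩`. -/
def s (k : ℕ) (v : H) : ℂ := inner ℂ (sinVec k) v

/-- The eigenspace `G_k` of `L₀` for the eigenvalue `4k²`. -/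
def G (k : ℕ) : Submodule ℂ H := Submodule.span ℂ {cosVec k, sinVec k}

instance (k : ℕ) : FiniteDimensional ℂ (G k) :=
  FiniteDimensional.span_of_finite ℂ (Set.toFinite {cosVec k, sinVec k})

/-- The squared norm `‖v_k‖²` of the orthogonal projection `v_k` of `v` onto `G_k`. -/
def normSqProj (k : ℕ) (v : H) : ℝ := ‖(G k).starProjection v‖ ^ 2

/-- The function `v` is real. -/
def IsReal (v : H) : Prop := ∀ᵐ x ∂mu, ((v : ℝ → ℂ) x).im = 0

/-- `w(x) = v(x) + x - π/2`. -/
def oddShift (v : H) : H :=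
  v + ofContinuous (fun x => ((x - Real.pi / 2 : ℝ) : ℂ)) (by fun_prop)

/-- `ŵ(x) = v(x) + (x - π/2)²`. -/
def evenShift (v : H) : H :=
  v + ofContinuous (fun x => (((x - Real.pi / 2) ^ 2 : ℝ) : ℂ)) (by fun_prop)

open scoped Classical in
/-- The multiplicity of the real number `x` in the spectrum `{4k² : k ≥ 0}` of `L₀`: it is `1` for
`x = 0`, `2` for `x = 4k²` with `k ≥ 1`, and `0` otherwise. -/
def baseMult (x : ℝ) : ℕ :=
  if x = 0 then 1 else if ∃ k : ℕ, x = 4 * (k : ℝ) ^ 2 then 2 else 0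

/-- The real numbers which have a larger multiplicity in the spectrum `S` than in that of `L₀`.
For `S = σ(L(α, v))` these are the zeros `μ` of `1 + α ⟨(L₀ - z)⁻¹ v, v⟩`. -/
def gained (S : Set (ℂ × ℕ)) : Set ℝ := {x | ∃ n, ((x : ℂ), n) ∈ S ∧ baseMult x < n}

/-- The real numbers which have a smaller multiplicity in the spectrum `S` than in that of `L₀`.
For `S = σ(L(α, v))` with `α ≠ 0` these are the points `4k²` with `v_k ≠ 0`. -/
def lost (S : Set (ℂ × ℕ)) : Set ℝ :=
  {x | 0 < baseMult x ∧ ∀ n, ((x : ℂ), n) ∈ S → n < baseMult x}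

/-- The elementary factor `1 - z/a` with the zero `a`; for `a = 0` it is `z`. -/
def factor (a : ℝ) (z : ℂ) : ℂ := if a = 0 then z else 1 - z / a

/-- The residue-type product
`A · 4p² · ∏_{μ} (1 - 4p²/μ) / ∏_{a ≠ 4p²} (1 - 4p²/a)` over `μ ∈ gained S` and `a ∈ lost S`, with
`-1` in place of the factor `4p²` if `p = 0`; it is zero if `4p²` is not in `lost S`. -/
def residueProduct (S : Set (ℂ × ℕ)) (A : ℂ) (p : ℕ) : ℂ :=
  open scoped Classical in
  if (4 * (p : ℝ) ^ 2) ∈ lost S then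
    A * (if p = 0 then -1 else 4 * (p : ℂ) ^ 2) *
      (∏' m : gained S, factor m (4 * (p : ℂ) ^ 2)) /
      (∏' a : ↥(lost S \ {4 * (p : ℝ) ^ 2}), factor a (4 * (p : ℂ) ^ 2))
  else 0

/-- The numbers `r 0, r 1, …` are computed from the counted spectrum `S` by the product formulas.
All infinite products converge, and the constant `A` is computed from `S` by
`1/A = lim_{y → ∞} ∏_{μ} (1 - iy/μ) / ∏_{a} (1 - iy/a)`. -/
def GivenByProducts (S : Set (ℂ × ℕ)) (r : ℕ → ℝ) : Prop :=
  (∀ z : ℂ, Multipliable fun m : gained S => factor m z) ∧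
  (∀ z : ℂ, Multipliable fun a : lost S => factor a z) ∧
  (∀ z : ℂ, ∀ p : ℕ, Multipliable fun a : ↥(lost S \ {4 * (p : ℝ) ^ 2}) => factor a z) ∧
  ∃ A : ℂ, A ≠ 0 ∧
    Tendsto (fun y : ℝ => (∏' m : gained S, factor m (Complex.I * y)) /
      (∏' a : lost S, factor a (Complex.I * y))) atTop (𝓝 A⁻¹) ∧
    ∀ p : ℕ, (r p : ℂ) = residueProduct S A p

end NonlocalPeriodic

end

noncomputable section

namespace NonlocalPeriodic

/-! The operator `L0` is diagonal with respect to the spaces `G k` (`mem_graphL0_iff`), so the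
eigenvalue equation of `L α v` splits into the equations `(4k² - x) y_k + α⟨y, v⟩ v_k = 0`.
Everything is governed by the function F(x) = 1 + ∑ α‖v_p‖² / (4p² - x). At a pole of F the
multiplicity drops, because y must become orthogonal to v (`perturbedModes_lt_freeModes`). Away from
the poles, K = (L₀ - x)⁻¹ αv absorbs the rank-one term: the eigenspace is unchanged if F(x) ≠ 0 and
acquires K if F(x) = 0. Hence the points of `lost` are the poles of F and those of `gained` are its
real zeros. Only dimensions of eigenspaces enter, so no further analysis of the spectrum is needed.

It remains to recover F from its zeros and poles. All residues have the sign of α, so zeros and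
poles interlace. For finitely many poles the numerator is identified by comparing polynomials
(`exists_shifts_finset`), and the distances δ from the poles to the attached zeros satisfy ∑ δ ≤ ∑ c
(`sum_shifts_le`). This uniform ℓ¹ bound permits a compactness limit over finite sets of poles
(`exists_shifts_of_pos`), with no growth theory of entire functions. The outcome is A ∏ φ_μ = F ∏
φ_a together with its residue form (`exists_factorization`); the constant A is fixed by F(iy) → 1 as
y → ∞. Thus the counted spectrum determines every α‖v_p‖².

Adding x - π/2 changes only the sine coefficients and adding (x - π/2)² only the cosine ones, each
by a known nonzero amount for k ≥ 1, as well as c₀ in the second case. For real v the resulting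
difference of squared norms is affine in the single coefficient that moved, and solving for it gives
the formulas. Uniqueness then reduces to α = α': Parseval gives this when ‖v‖ = 1, and a sign
argument at k = 1 gives it when |α| = 1. -/

/-! ### Finitely many poles with positive weights -/

/-- The rational function `1 + ∑ c / (b - x)` over a finite set of poles. -/
def finiteSum {ι : Type*} (s : Finset ι) (b c : ι → ℝ) (x : ℝ) : ℝ := 1 + ∑ p ∈ s, c p / (b p - x)

/-- Multiplying by `b p - x` removes the singularity and leaves the value `c p > 0` at the pole.
Hence the function is positive just left of each pole and negative just right of it. -/
theorem eventually_finiteSum_mul_pos {ι : Type*} [DecidableEq ι] {s : Finset ι} {b c : ι → ℝ}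
    (hb : Set.InjOn b s) (hc : ∀ p ∈ s, 0 < c p) {p : ι} (hp : p ∈ s) :
    ∀ᶠ x in 𝓝 (b p), x ≠ b p → 0 < finiteSum s b c x * (b p - x) := by
  have h1 : ContinuousAt
      (fun x => (b p - x) * (1 + ∑ q ∈ s.erase p, c q / (b q - x)) + c p) (b p) := by
    refine ContinuousAt.add (ContinuousAt.mul (by fun_prop) (continuousAt_const.add ?_))
      continuousAt_const
    refine tendsto_finsetSum _ fun q hq => ?_
    refine ContinuousAt.div continuousAt_const (by fun_prop) ?_
    rw [sub_ne_zero]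
    exact fun h => (Finset.mem_erase.1 hq).1 (hb (Finset.mem_erase.1 hq).2 hp h)
  have h2 := h1.eventually_const_lt (show (0 : ℝ) < _ by simpa using hc p hp)
  filter_upwards [h2] with x hx hne
  have : b p - x ≠ 0 := sub_ne_zero.2 hne.symm
  have e : finiteSum s b c x * (b p - x)
      = (b p - x) * (1 + ∑ q ∈ s.erase p, c q / (b q - x)) + c p := by
    rw [finiteSum, ← Finset.add_sum_erase s _ hp]
    field_simp
    ring
  rwa [e]

/-- Intermediate value theorem on the gap `U` to the right of the pole. The function is negative at
the left end; it is positive near the next pole or, if there is none, tends to 1 at infinity. -/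
theorem exists_zero_right_of_pole {ι : Type*} [DecidableEq ι] {s : Finset ι} {b c : ι → ℝ}
    (hb : Set.InjOn b s) (hc : ∀ p ∈ s, 0 < c p) {p : ι} (hp : p ∈ s) :
    ∃ x, b p < x ∧ (∀ q ∈ s, b p < b q → x < b q) ∧ finiteSum s b c x = 0 := by
  set U : Set ℝ := {x | b p < x ∧ ∀ q ∈ s, b p < b q → x < b q} with hU
  have hconn : IsPreconnected U := by
    refine Set.OrdConnected.isPreconnected ⟨fun x hx y hy z hz => ?_⟩
    exact ⟨hx.1.trans_le hz.1, fun q hq h => hz.2.trans_lt (hy.2 q hq h)⟩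
  have hcont : ContinuousOn (finiteSum s b c) U := by
    refine continuousOn_const.add (continuousOn_finsetSum _ fun q hq => ?_)
    refine ContinuousOn.div continuousOn_const (by fun_prop) fun x hx => ?_
    rw [sub_ne_zero]
    rintro rfl
    exact lt_irrefl _ (hx.2 q hq hx.1)
  have hneg : ∃ x ∈ U, finiteSum s b c x < 0 := by
    have h1 : ∀ᶠ x in 𝓝[>] (b p), x ∈ Set.Ioi (b p) := self_mem_nhdsWithin
    have h2 : ∀ᶠ x in 𝓝[>] (b p), ∀ q ∈ s, b p < b q → x < b q := by
      rw [eventually_all_finset]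
      intro q _
      by_cases h : b p < b q
      · filter_upwards [nhdsWithin_le_nhds (Iio_mem_nhds h)] with x hx _ using hx
      · exact Eventually.of_forall fun x h' => absurd h' h
    obtain ⟨x, hx1, hx2, hx3⟩ := (h1.and (h2.and
      (nhdsWithin_le_nhds (eventually_finiteSum_mul_pos hb hc hp)))).exists
    have hx1 : b p < x := hx1
    have := hx3 hx1.ne'
    exact ⟨x, ⟨hx1, hx2⟩, by nlinarith⟩
  have hpos : ∃ x ∈ U, 0 < finiteSum s b c x := by
    rcases (s.filter fun q => b p < b q).eq_empty_or_nonempty with h | h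
    · have h0 : Tendsto (finiteSum s b c) atTop (𝓝 (1 + ∑ q ∈ s, 0)) := by
        refine tendsto_const_nhds.add (tendsto_finsetSum _ fun q _ => ?_)
        exact Tendsto.const_div_atBot
          (tendsto_atBot_add_const_left _ _ tendsto_neg_atTop_atBot) _
      obtain ⟨x, hx1, hx2⟩ := ((h0.eventually_const_lt (show (0 : ℝ) < _ by simp)).and
        (eventually_gt_atTop (b p))).exists
      refine ⟨x, ⟨hx2, fun q hq hlt => ?_⟩, hx1⟩
      have : q ∈ s.filter fun q => b p < b q := Finset.mem_filter.2 ⟨hq, hlt⟩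
      simp [h] at this
    · obtain ⟨q, hq, hmin⟩ := Finset.exists_min_image _ b h
      rw [Finset.mem_filter] at hq
      have h1 : ∀ᶠ x in 𝓝[<] (b q), x ∈ Set.Iio (b q) := self_mem_nhdsWithin
      have h2 : ∀ᶠ x in 𝓝[<] (b q), b p < x := nhdsWithin_le_nhds (Ioi_mem_nhds hq.2)
      obtain ⟨x, hx1, hx2, hx3⟩ := (h1.and (h2.and
        (nhdsWithin_le_nhds (eventually_finiteSum_mul_pos hb hc hq.1)))).exists
      have hx1 : x < b q := hx1
      have := hx3 hx1.ne
      exact ⟨x, ⟨hx2, fun r hr hlt => hx1.trans_le (hmin r (Finset.mem_filter.2 ⟨hr, hlt⟩))⟩,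
        by nlinarith⟩
  obtain ⟨x0, hx0, h0⟩ := hneg
  obtain ⟨x1, hx1, h1⟩ := hpos
  obtain ⟨x, hx, hx'⟩ := hconn.intermediate_value hx0 hx1 hcont ⟨h0.le, h1.le⟩
  exact ⟨x, hx.1, hx.2, hx'⟩

/-- A rational function `1 + ∑ c / (b - z)` with positive weights is a product over its poles and
its zeros, which interlace. -/
theorem exists_shifts_finset {ι : Type*} [DecidableEq ι] (s : Finset ι) (b c : ι → ℝ)
    (hb : Set.InjOn b s) (hc : ∀ p ∈ s, 0 < c p) :
    ∃ δ : ι → ℝ, (∀ p, 0 ≤ δ p) ∧ (∀ p ∈ s, ∀ q ∈ s, b p < b q → b p + δ p ≤ b q) ∧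
      ∀ z : ℂ, ∏ p ∈ s, ((b p : ℂ) + δ p - z) =
        ∏ p ∈ s, ((b p : ℂ) - z) + ∑ p ∈ s, (c p : ℂ) * ∏ q ∈ s.erase p, ((b q : ℂ) - z) := by
  -- Outside `s` the default is `b p` itself, that is, a zero shift.
  have hex : ∀ p : ι, ∃ x : ℝ, b p ≤ x ∧ (p ∈ s → b p < x ∧ (∀ q ∈ s, b p < b q → x < b q) ∧
      finiteSum s b c x = 0) := by
    intro p
    by_cases hp : p ∈ s
    · obtain ⟨x, hx⟩ := exists_zero_right_of_pole hb hc hp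
      exact ⟨x, hx.1.le, fun _ => hx⟩
    · exact ⟨b p, le_rfl, fun h => absurd h hp⟩
  choose m hm0 hm using hex
  refine ⟨fun p => m p - b p, fun p => sub_nonneg.2 (hm0 p), fun p hp q hq h => ?_, fun z => ?_⟩
  · simpa using ((hm p hp).2.1 q hq h).le
  have hinj : Set.InjOn (fun p => (m p : ℂ)) s := by
    intro p hp q hq h
    have h : m p = m q := by simpa using h
    by_contra hne
    rcases lt_or_gt_of_ne (fun h' => hne (hb hp hq h')) with h' | h'
    · exact absurd ((hm p hp).2.1 q hq h') (by rw [h]; exact (hm q hq).1.not_gt)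
    · exact absurd ((hm q hq).2.1 p hp h') (by rw [← h]; exact (hm p hp).1.not_gt)
  set Q : Polynomial ℂ := ∏ p ∈ s, (Polynomial.X - Polynomial.C (m p : ℂ)) with hQ
  set P : Polynomial ℂ := ∏ p ∈ s, (Polynomial.X - Polynomial.C (b p : ℂ)) with hP
  set R : Polynomial ℂ := ∑ p ∈ s, Polynomial.C (c p : ℂ) *
    ∏ q ∈ s.erase p, (Polynomial.X - Polynomial.C (b q : ℂ)) with hR
  have hPd : P.degree = s.card := by
    rw [hP, Polynomial.degree_prod]; simp
  have hQd : Q.degree = s.card := by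
    rw [hQ, Polynomial.degree_prod]; simp
  have hPm : P.Monic := Polynomial.monic_prod_of_monic _ _ fun p _ => Polynomial.monic_X_sub_C _
  have hQm : Q.Monic := Polynomial.monic_prod_of_monic _ _ fun p _ => Polynomial.monic_X_sub_C _
  have hRd : R.degree < s.card := by
    refine (Polynomial.degree_sum_le _ _).trans_lt ?_
    rw [Finset.sup_lt_iff (WithBot.bot_lt_coe _)]
    intro p hp
    refine (Polynomial.degree_mul_le _ _).trans_lt ?_
    have h1 : (Polynomial.C (c p : ℂ)).degree ≤ 0 := Polynomial.degree_C_le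
    have h2 : (∏ q ∈ s.erase p, (Polynomial.X - Polynomial.C (b q : ℂ))).degree
        = ((s.erase p).card : WithBot ℕ) := by
      rw [Polynomial.degree_prod]; simp
    rw [h2]
    have h3 := Finset.card_erase_lt_of_mem hp
    calc _ ≤ (0 : WithBot ℕ) + ((s.erase p).card : WithBot ℕ) := by gcongr
      _ < s.card := by rw [zero_add]; exact_mod_cast h3
  have hdeg : (Q - (P - R)).degree < s.card := by
    have h1 : (Q - P).degree < s.card := by
      rcases eq_or_ne Q 0 with h0 | h0
      · exact absurd h0 hQm.ne_zero
      · rw [← hQd]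
        exact Polynomial.degree_sub_lt_left (hQd.trans hPd.symm) h0
          (by rw [hQm.leadingCoeff, hPm.leadingCoeff])
    have : Q - (P - R) = (Q - P) + R := by ring
    rw [this]
    exact (Polynomial.degree_add_le _ _).trans_lt (max_lt h1 hRd)
  -- `Q` and `P` are monic of degree `s.card` and `R` has smaller degree, so the difference has
  -- degree below `s.card`. It vanishes at the `s.card` distinct points `m p`, where `P - R` equals
  -- `P` times the rational function.
  have heq : Q = P - R := by
    refine Polynomial.eq_of_degree_sub_lt_of_eval_index_eq s hinj hdeg fun p hp => ?_
    have hQ0 : Q.eval (m p : ℂ) = 0 := by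
      rw [hQ, Polynomial.eval_prod]
      exact Finset.prod_eq_zero hp (by simp)
    have hne : ∀ q ∈ s, (m p : ℂ) - b q ≠ 0 := by
      intro q hq h
      have h : m p = b q := by
        have := sub_eq_zero.1 h
        exact_mod_cast this
      have h1 := (hm p hp).1
      rw [h] at h1
      have h2 := (hm p hp).2.1 q hq h1
      rw [h] at h2
      exact lt_irrefl _ h2
    have hz := (hm p hp).2.2
    have hz' : (1 : ℂ) + ∑ q ∈ s, (c q : ℂ) / (b q - m p) = 0 := by
      rw [finiteSum] at hz
      exact_mod_cast hz
    have hPe : (P - R).eval (m p : ℂ)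
        = (∏ q ∈ s, ((m p : ℂ) - b q)) * (1 + ∑ q ∈ s, (c q : ℂ) / (b q - m p)) := by
      rw [Polynomial.eval_sub, hP, hR, Polynomial.eval_prod, Polynomial.eval_finsetSum, mul_add,
        Finset.mul_sum, mul_one, sub_eq_add_neg, ← Finset.sum_neg_distrib]
      congr 1
      · simp
      · refine Finset.sum_congr rfl fun q hq => ?_
        rw [← Finset.mul_prod_erase s _ hq, Polynomial.eval_mul, Polynomial.eval_prod]
        simp only [Polynomial.eval_C, Polynomial.eval_sub, Polynomial.eval_X]
        have h1 := hne q hq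
        have h2 : (b q : ℂ) - m p ≠ 0 := fun h => h1 (by linear_combination -h)
        have : (c q : ℂ) / (b q - m p) = - ((c q : ℂ) / (m p - b q)) := by
          rw [← div_neg]; ring_nf
        rw [this]
        field_simp
    rw [hQ0, hPe, hz', mul_zero]
  have hev := congrArg (Polynomial.eval z) heq
  rw [Polynomial.eval_sub, hQ, hP, hR, Polynomial.eval_prod, Polynomial.eval_prod,
    Polynomial.eval_finsetSum] at hev
  simp only [Polynomial.eval_mul, Polynomial.eval_prod, Polynomial.eval_C, Polynomial.eval_sub,
    Polynomial.eval_X] at hev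
  -- Passing from `z - b` to `b - z` costs one sign per factor; an erased product has one factor
  -- fewer, which turns the minus before `R` into a plus.
  have hneg : ∀ (t : Finset ι) (f : ι → ℂ), ∏ p ∈ t, (f p - z) = (-1) ^ t.card *
      ∏ p ∈ t, (z - f p) := by
    intro t f
    rw [← Finset.prod_const, ← Finset.prod_mul_distrib]
    exact Finset.prod_congr rfl fun p _ => by ring
  have e1 : ∏ p ∈ s, ((b p : ℂ) + ((m p - b p : ℝ) : ℂ) - z) = (-1) ^ s.card *
      ∏ p ∈ s, (z - (m p : ℂ)) := by
    rw [← hneg]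
    exact Finset.prod_congr rfl fun p _ => by push_cast; ring
  rw [e1, hneg s, hev, mul_sub, sub_eq_add_neg, Finset.mul_sum, ← Finset.sum_neg_distrib]
  congr 1
  refine Finset.sum_congr rfl fun p hp => ?_
  rw [hneg]
  have : (-1 : ℂ) ^ s.card = - (-1) ^ (s.erase p).card := by
    rw [← Finset.card_erase_add_one hp, pow_succ]; ring
  rw [this]
  ring

/-! ### Passage to infinitely many poles -/

theorem tendsto_inv_sub_cofinite {ι : Type*} {b : ι → ℝ}
    (hb : Tendsto (fun p => |b p|) cofinite atTop) (z : ℂ) :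
    Tendsto (fun p => ((b p : ℂ) - z)⁻¹) cofinite (𝓝 0) := by
  rw [tendsto_zero_iff_norm_tendsto_zero]
  simp only [norm_inv]
  refine tendsto_inv_atTop_zero.comp (tendsto_atTop_mono (fun p => ?_)
    (tendsto_atTop_add_const_right _ (-‖z‖) hb))
  have := norm_sub_norm_le (b p : ℂ) z
  rw [Complex.norm_real, Real.norm_eq_abs] at this
  linarith

theorem exists_norm_le_of_tendsto_cofinite {ι : Type*} {w : ι → ℂ}
    (hw : Tendsto w cofinite (𝓝 0)) : ∃ M, 0 ≤ M ∧ ∀ p, ‖w p‖ ≤ M := by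
  have h := hw.norm.bddAbove_range_of_cofinite
  obtain ⟨M, hM⟩ := h
  exact ⟨max M 0, le_max_right _ _, fun p => (hM ⟨p, rfl⟩).trans (le_max_left _ _)⟩

theorem summable_norm_mul_of_tendsto_cofinite {ι : Type*} {δ : ι → ℝ} (hδ : Summable δ)
    {w : ι → ℂ} (hw : Tendsto w cofinite (𝓝 0)) : Summable fun p => ‖(δ p : ℂ) * w p‖ := by
  obtain ⟨M, hM0, hM⟩ := exists_norm_le_of_tendsto_cofinite hw
  refine Summable.of_nonneg_of_le (fun p => norm_nonneg _) (fun p => ?_) (hδ.norm.mul_right M)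
  rw [norm_mul, Complex.norm_real]
  exact mul_le_mul_of_nonneg_left (hM p) (norm_nonneg _)

/-- Passage to the limit in products `∏ (1 + d w)` when the `d` have bounded `ℓ¹` norms and
converge pointwise, and `w` vanishes at infinity. -/
theorem tendsto_prod_one_add {ι : Type*} {U : Filter (Finset ι)}
    (hU : U ≤ atTop) {d : Finset ι → ι → ℝ} (hd0 : ∀ s p, 0 ≤ d s p) {C : ℝ}
    (hdC : ∀ s, ∑ p ∈ s, d s p ≤ C) {δ : ι → ℝ} (hδ : Summable δ)
    (hlim : ∀ p, Tendsto (fun s => d s p) U (𝓝 (δ p))) {w : ι → ℂ}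
    (hw : Tendsto w cofinite (𝓝 0)) :
    Tendsto (fun s => ∏ p ∈ s, (1 + (d s p : ℂ) * w p)) U (𝓝 (∏' p, (1 + (δ p : ℂ) * w p))) := by
  classical
  have hC : 0 ≤ C := by simpa using hdC ∅
  obtain ⟨M, hM0, hM⟩ := exists_norm_le_of_tendsto_cofinite hw
  have hprod : Tendsto (fun t => ∏ p ∈ t, (1 + (δ p : ℂ) * w p)) atTop
      (𝓝 (∏' p, (1 + (δ p : ℂ) * w p))) :=
    (multipliable_one_add_of_summable (summable_norm_mul_of_tendsto_cofinite hδ hw)).hasProd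
  rw [Metric.tendsto_nhds]
  intro ε hε
  -- Where ‖w‖ ≤ η the tail product is within exp(Cη) - 1 of 1, while the finite part is bounded by
  -- exp(CM). The number η is chosen to make the combined error less than ε/3, and `t` will contain
  -- all indices with ‖w‖ ≥ η.
  have hexp : Tendsto (fun η : ℝ => Real.exp (C * M) * (Real.exp (C * η) - 1)) (𝓝 0) (𝓝 0) := by
    have : Continuous fun η : ℝ => Real.exp (C * M) * (Real.exp (C * η) - 1) := by fun_prop
    simpa using this.tendsto 0
  have hexp' : ∀ᶠ η in 𝓝[>] (0 : ℝ), Real.exp (C * M) * (Real.exp (C * η) - 1) < ε / 3 :=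
    nhdsWithin_le_nhds (hexp.eventually_lt_const (by positivity))
  have hpos : ∀ᶠ η in 𝓝[>] (0 : ℝ), 0 < η := eventually_mem_nhdsWithin
  obtain ⟨η, hη1, hη0⟩ := (hexp'.and hpos).exists
  have hfin : {p | ¬ ‖w p‖ < η}.Finite := by
    have := hw.norm.eventually_lt_const (show ‖(0 : ℂ)‖ < η by simpa using hη0)
    exact this
  obtain ⟨t, ht1, ht2⟩ := ((Metric.tendsto_nhds.1 hprod (ε / 3) (by positivity)).and
    (eventually_ge_atTop hfin.toFinset)).exists
  have hfix : Tendsto (fun s => ∏ p ∈ t, (1 + (d s p : ℂ) * w p)) U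
      (𝓝 (∏ p ∈ t, (1 + (δ p : ℂ) * w p))) := by
    refine tendsto_finsetProd _ fun p _ => tendsto_const_nhds.add (Tendsto.mul ?_ tendsto_const_nhds)
    exact (Complex.continuous_ofReal.tendsto _).comp (hlim p)
  filter_upwards [Metric.tendsto_nhds.1 hfix (ε / 3) (by positivity),
    hU (eventually_ge_atTop t)] with s hs1 hts
  have hts : t ⊆ s := hts
  have hsplit : ∏ p ∈ s, (1 + (d s p : ℂ) * w p) = (∏ p ∈ s \ t, (1 + (d s p : ℂ) * w p)) *
      ∏ p ∈ t, (1 + (d s p : ℂ) * w p) := (Finset.prod_sdiff hts).symm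
  have hbig : ‖∏ p ∈ t, (1 + (d s p : ℂ) * w p)‖ ≤ Real.exp (C * M) := by
    refine (Finset.norm_prod_le _ _).trans ?_
    calc ∏ p ∈ t, ‖1 + (d s p : ℂ) * w p‖ ≤ ∏ p ∈ t, Real.exp (d s p * M) := by
          refine Finset.prod_le_prod (fun p _ => norm_nonneg _) fun p _ => ?_
          refine (norm_add_le _ _).trans ?_
          rw [norm_one, norm_mul, Complex.norm_real, Real.norm_of_nonneg (hd0 s p), add_comm]
          refine le_trans ?_ (Real.add_one_le_exp _)
          gcongr
          · exact hd0 s p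
          · exact hM p
      _ = Real.exp ((∑ p ∈ t, d s p) * M) := by rw [← Real.exp_sum, Finset.sum_mul]
      _ ≤ Real.exp (C * M) := by
          gcongr
          exact (Finset.sum_le_sum_of_subset_of_nonneg hts fun p _ _ => hd0 s p).trans (hdC s)
  have hsmall : ‖∏ p ∈ s \ t, (1 + (d s p : ℂ) * w p) - 1‖ ≤ Real.exp (C * η) - 1 := by
    refine (Finset.norm_prod_one_add_sub_one_le _ _).trans ?_
    gcongr
    calc ∑ p ∈ s \ t, ‖(d s p : ℂ) * w p‖ ≤ ∑ p ∈ s \ t, d s p * η := by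
          refine Finset.sum_le_sum fun p hp => ?_
          rw [norm_mul, Complex.norm_real, Real.norm_of_nonneg (hd0 s p)]
          refine mul_le_mul_of_nonneg_left ?_ (hd0 s p)
          by_contra hcon
          refine (Finset.mem_sdiff.1 hp).2 (ht2 (hfin.mem_toFinset.2 ?_))
          exact fun h => hcon h.le
      _ = (∑ p ∈ s \ t, d s p) * η := by rw [Finset.sum_mul]
      _ ≤ C * η := by
          gcongr
          exact (Finset.sum_le_sum_of_subset_of_nonneg Finset.sdiff_subset
            fun p _ _ => hd0 s p).trans (hdC s)
  have h1 : dist (∏ p ∈ s, (1 + (d s p : ℂ) * w p)) (∏ p ∈ t, (1 + (d s p : ℂ) * w p))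
      < ε / 3 := by
    rw [dist_eq_norm, hsplit, ← sub_one_mul, norm_mul, mul_comm]
    refine lt_of_le_of_lt ?_ hη1
    gcongr
  have h2 := dist_triangle4 (∏ p ∈ s, (1 + (d s p : ℂ) * w p))
    (∏ p ∈ t, (1 + (d s p : ℂ) * w p)) (∏ p ∈ t, (1 + (δ p : ℂ) * w p))
    (∏' p, (1 + (δ p : ℂ) * w p))
  linarith

theorem one_add_sum_le_prod_one_add {ι : Type*} (s : Finset ι) {f : ι → ℝ}
    (hf : ∀ p ∈ s, 0 ≤ f p) : 1 + ∑ p ∈ s, f p ≤ ∏ p ∈ s, (1 + f p) := by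
  classical
  induction s using Finset.induction_on with
  | empty => simp
  | insert q s hq ih =>
    have h1 := ih fun p hp => hf p (Finset.mem_insert_of_mem hp)
    have h2 := hf q (Finset.mem_insert_self q s)
    have h3 : 0 ≤ ∑ p ∈ s, f p :=
      Finset.sum_nonneg fun p hp => hf p (Finset.mem_insert_of_mem hp)
    rw [Finset.sum_insert hq, Finset.prod_insert hq]
    nlinarith [mul_nonneg h2 h3]

/-- At z = -t, division by ∏ (b + t) gives 1 + ∑ δ/(b + t) ≤ ∏ (1 + δ/(b + t)) = 1 + ∑ c/(b + t).
Multiplying by t and letting t → ∞ compares the two sums. The bound does not depend on the finite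
set once `c` is summable. -/
theorem sum_shifts_le {ι : Type*} [DecidableEq ι] (s : Finset ι) (b c δ : ι → ℝ)
    (h0 : ∀ p, 0 ≤ δ p)
    (h : ∀ z : ℂ, ∏ p ∈ s, ((b p : ℂ) + δ p - z) =
        ∏ p ∈ s, ((b p : ℂ) - z) + ∑ p ∈ s, (c p : ℂ) * ∏ q ∈ s.erase p, ((b q : ℂ) - z)) :
    ∑ p ∈ s, δ p ≤ ∑ p ∈ s, c p := by
  have key : ∀ p, Tendsto (fun t : ℝ => t / (b p + t)) atTop (𝓝 1) := by
    intro p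
    have h1 : Tendsto (fun t : ℝ => 1 - b p / (b p + t)) atTop (𝓝 (1 - 0)) :=
      tendsto_const_nhds.sub (Tendsto.const_div_atTop (tendsto_atTop_add_const_left _ _ tendsto_id) _)
    rw [sub_zero] at h1
    refine h1.congr' ?_
    filter_upwards [eventually_gt_atTop (-b p)] with t ht
    have : b p + t ≠ 0 := by linarith
    field_simp
    ring
  have hl : Tendsto (fun t : ℝ => ∑ p ∈ s, δ p * (t / (b p + t))) atTop (𝓝 (∑ p ∈ s, δ p)) := by
    simpa using tendsto_finsetSum s fun p _ => (key p).const_mul (δ p)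
  have hr : Tendsto (fun t : ℝ => ∑ p ∈ s, c p * (t / (b p + t))) atTop (𝓝 (∑ p ∈ s, c p)) := by
    simpa using tendsto_finsetSum s fun p _ => (key p).const_mul (c p)
  refine le_of_tendsto_of_tendsto hl hr ?_
  have hev : ∀ᶠ t : ℝ in atTop, ∀ p ∈ s, 0 < b p + t := by
    rw [eventually_all_finset]
    intro p _
    filter_upwards [eventually_gt_atTop (-b p)] with t ht
    linarith
  filter_upwards [hev, eventually_gt_atTop 0] with t ht ht0
  have h1 : ∏ p ∈ s, (b p + δ p + t) =
      ∏ p ∈ s, (b p + t) + ∑ p ∈ s, c p * ∏ q ∈ s.erase p, (b q + t) := by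
    have := h (-t)
    simp only [sub_neg_eq_add] at this
    exact_mod_cast this
  have hpos : 0 < ∏ p ∈ s, (b p + t) := Finset.prod_pos ht
  have h2 : ∏ p ∈ s, (1 + δ p / (b p + t)) = 1 + ∑ p ∈ s, c p / (b p + t) := by
    have e1 : ∏ p ∈ s, (1 + δ p / (b p + t)) = (∏ p ∈ s, (b p + δ p + t)) / ∏ p ∈ s, (b p + t) := by
      rw [← Finset.prod_div_distrib]
      refine Finset.prod_congr rfl fun p hp => ?_
      have := (ht p hp).ne'
      field_simp
      ring
    rw [e1, h1, add_div, div_self hpos.ne', Finset.sum_div]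
    congr 1
    refine Finset.sum_congr rfl fun p hp => ?_
    rw [← Finset.mul_prod_erase s _ hp]
    have h3 := (ht p hp).ne'
    have h4 : ∏ q ∈ s.erase p, (b q + t) ≠ 0 :=
      (Finset.prod_pos fun q hq => ht q (Finset.mem_of_mem_erase hq)).ne'
    field_simp
  have h3 := one_add_sum_le_prod_one_add s (f := fun p => δ p / (b p + t))
    (fun p hp => div_nonneg (h0 p) (ht p hp).le)
  rw [h2] at h3
  have h4 : ∑ p ∈ s, δ p / (b p + t) ≤ ∑ p ∈ s, c p / (b p + t) := by linarith
  calc ∑ p ∈ s, δ p * (t / (b p + t)) = t * ∑ p ∈ s, δ p / (b p + t) := by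
        rw [Finset.mul_sum]; exact Finset.sum_congr rfl fun p _ => by ring
    _ ≤ t * ∑ p ∈ s, c p / (b p + t) := by gcongr
    _ = _ := by rw [Finset.mul_sum]; exact Finset.sum_congr rfl fun p _ => by ring

/-- The function `1 + ∑ c / (b - z)` with positive summable weights is an infinite product over its
poles and its zeros, which interlace. -/
theorem exists_shifts_of_pos {ι : Type*} {b c : ι → ℝ} (hb : Function.Injective b)
    (hbt : Tendsto (fun p => |b p|) cofinite atTop) (hc : ∀ p, 0 < c p) (hcs : Summable c) :
    ∃ δ : ι → ℝ, (∀ p, 0 < δ p) ∧ Summable δ ∧ (∀ p q, b p < b q → b p + δ p ≤ b q) ∧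
      (∀ z : ℂ, (∀ p, (b p : ℂ) ≠ z) →
        ∏' p, (1 + (δ p : ℂ) * ((b p : ℂ) - z)⁻¹) = 1 + ∑' p, (c p : ℂ) * ((b p : ℂ) - z)⁻¹) ∧
      ∀ q, (δ q : ℂ) * ∏' p, (1 + (δ p : ℂ) * ((b p : ℂ) - b q)⁻¹) = c q := by
  classical
  have hfin := fun s : Finset ι => exists_shifts_finset s b c hb.injOn fun p _ => hc p
  choose d hd0 hdi hd using hfin
  set C := ∑' p, c p with hC
  have hdC : ∀ s, ∑ p ∈ s, d s p ≤ C := fun s =>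
    (sum_shifts_le s b c (d s) (hd0 s) (hd s)).trans
      (hcs.sum_le_tsum _ fun p _ => (hc p).le)
  -- Along an ultrafilter finer than `atTop`, compactness of `[0, C]` makes all the shifts converge
  -- at once, so no diagonal subsequence is required.
  obtain ⟨U, hU⟩ := Ultrafilter.exists_le (atTop : Filter (Finset ι))
  have hmem : ∀ p, ∀ᶠ s in (U : Filter (Finset ι)), p ∈ s := fun p =>
    hU ((eventually_ge_atTop {p}).mono fun s hs => hs (Finset.mem_singleton_self p))
  have hex : ∀ p, ∃ x ∈ Set.Icc 0 C, Tendsto (fun s => d s p) U (𝓝 x) := by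
    intro p
    have h1 : (U.map fun s => d s p : Ultrafilter ℝ) ≤ 𝓟 (Set.Icc 0 C) := by
      rw [le_principal_iff, Ultrafilter.coe_map]
      refine (hmem p).mono fun s hs => ?_
      exact ⟨hd0 s p, (Finset.single_le_sum (fun q _ => hd0 s q) hs).trans (hdC s)⟩
    exact isCompact_Icc.ultrafilter_le_nhds _ h1
  choose δ hδC hδ using hex
  have hδ0 : ∀ p, 0 ≤ δ p := fun p => (hδC p).1
  have hδs : Summable δ := by
    refine summable_of_sum_le (c := C) hδ0 fun t => ?_
    refine le_of_tendsto (tendsto_finsetSum t fun p _ => hδ p) ?_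
    filter_upwards [hU (eventually_ge_atTop t)] with s hs
    exact (Finset.sum_le_sum_of_subset_of_nonneg hs fun p _ _ => hd0 s p).trans (hdC s)
  have hlim := fun z => tendsto_prod_one_add hU hd0 hdC hδs hδ (tendsto_inv_sub_cofinite hbt z)
  -- At z = b q only one term of the finite identity survives. By the convention 0⁻¹ = 0 the factor
  -- with p = q equals 1, so the full product is in fact taken over p ≠ q.
  have hres : ∀ q, (δ q : ℂ) * ∏' p, (1 + (δ p : ℂ) * ((b p : ℂ) - b q)⁻¹) = c q := by
    intro q
    have h1 := ((Complex.continuous_ofReal.tendsto _).comp (hδ q)).mul (hlim (b q))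
    refine tendsto_nhds_unique h1 (tendsto_const_nhds.congr' ?_)
    filter_upwards [hmem q] with s hs
    have h2 := hd s (b q)
    have h0 : ∏ p ∈ s, ((b p : ℂ) - b q) = 0 := Finset.prod_eq_zero hs (sub_self _)
    rw [h0, zero_add, Finset.sum_eq_single_of_mem q hs,
      ← Finset.mul_prod_erase s _ hs] at h2
    · have hne : ∀ p ∈ s.erase q, (b p : ℂ) - b q ≠ 0 := by
        intro p hp h
        refine (Finset.mem_erase.1 hp).1 (hb ?_)
        exact_mod_cast sub_eq_zero.1 h
      have h3 : ∏ p ∈ s, (1 + (d s p : ℂ) * ((b p : ℂ) - b q)⁻¹)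
          = (∏ p ∈ s.erase q, ((b p : ℂ) + d s p - b q)) / ∏ p ∈ s.erase q, ((b p : ℂ) - b q) := by
        rw [← Finset.mul_prod_erase s _ hs, ← Finset.prod_div_distrib]
        simp only [sub_self, inv_zero, mul_zero, add_zero, one_mul]
        refine Finset.prod_congr rfl fun p hp => ?_
        have := hne p hp
        field_simp
        ring
      have h4 : ∏ p ∈ s.erase q, ((b p : ℂ) - b q) ≠ 0 := Finset.prod_ne_zero_iff.2 hne
      simp only [Function.comp_apply]
      rw [h3, ← mul_div_assoc, eq_div_iff h4, ← h2]
      ring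
    · intro p _ hpq
      rw [Finset.prod_eq_zero (Finset.mem_erase.2 ⟨hpq.symm, hs⟩) (sub_self _), mul_zero]
  -- Limits give only δ ≥ 0; a zero shift would make the nonzero residue vanish.
  have hδpos : ∀ p, 0 < δ p := by
    intro p
    refine (hδ0 p).lt_of_ne fun h => ?_
    have := hres p
    rw [← h, Complex.ofReal_zero, zero_mul] at this
    exact (hc p).ne (by exact_mod_cast this)
  refine ⟨δ, hδpos, hδs, fun p q h => ?_, fun z hz => ?_, hres⟩
  · refine le_of_tendsto (tendsto_const_nhds.add (hδ p)) ?_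
    filter_upwards [hmem p, hmem q] with s hp hq
    exact hdi s p hp q hq h
  · refine tendsto_nhds_unique (hlim z) ?_
    have hs : HasSum (fun p => (c p : ℂ) * ((b p : ℂ) - z)⁻¹)
        (∑' p, (c p : ℂ) * ((b p : ℂ) - z)⁻¹) :=
      (summable_norm_mul_of_tendsto_cofinite hcs (tendsto_inv_sub_cofinite hbt z)).of_norm.hasSum
    refine (tendsto_const_nhds.add (Tendsto.mono_left hs hU)).congr fun s => ?_
    have hne : ∀ p, (b p : ℂ) - z ≠ 0 := fun p => sub_ne_zero.2 (hz p)
    have h4 : ∏ p ∈ s, ((b p : ℂ) - z) ≠ 0 := Finset.prod_ne_zero_iff.2 fun p _ => hne p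
    have h3 : ∏ p ∈ s, (1 + (d s p : ℂ) * ((b p : ℂ) - z)⁻¹)
        = (∏ p ∈ s, ((b p : ℂ) + d s p - z)) / ∏ p ∈ s, ((b p : ℂ) - z) := by
      rw [← Finset.prod_div_distrib]
      refine Finset.prod_congr rfl fun p _ => ?_
      have := hne p
      field_simp
      ring
    rw [h3, hd, add_div, div_self h4, Finset.sum_div]
    congr 1
    refine Finset.sum_congr rfl fun p hp => ?_
    rw [← Finset.mul_prod_erase s _ hp]
    have := hne p
    have h5 : ∏ q ∈ s.erase p, ((b q : ℂ) - z) ≠ 0 := Finset.prod_ne_zero_iff.2 fun p _ => hne p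
    field_simp

/-- The function `1 + ∑ c / (b - z)` with summable weights of one sign is an infinite product over
its poles `b` and its zeros `b + δ`. -/
theorem exists_shifts {ι : Type*} {b c : ι → ℝ} (hb : Function.Injective b)
    (hbt : Tendsto (fun p => |b p|) cofinite atTop) (hc : (∀ p, 0 < c p) ∨ ∀ p, c p < 0)
    (hcs : Summable c) :
    ∃ δ : ι → ℝ, (∀ p, 0 < δ p * c p) ∧ Summable δ ∧ Function.Injective (fun p => b p + δ p) ∧
      (∀ z : ℂ, (∀ p, (b p : ℂ) ≠ z) →
        ∏' p, (1 + (δ p : ℂ) * ((b p : ℂ) - z)⁻¹) = 1 + ∑' p, (c p : ℂ) * ((b p : ℂ) - z)⁻¹) ∧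
      ∀ q, (δ q : ℂ) * ∏' p, (1 + (δ p : ℂ) * ((b p : ℂ) - b q)⁻¹) = c q := by
  have hinj : ∀ {e δ : ι → ℝ}, Function.Injective e → (∀ p, 0 < δ p) →
      (∀ p q, e p < e q → e p + δ p ≤ e q) → Function.Injective (fun p => e p + δ p) := by
    intro e δ he h0 hi p q hpq
    have hpq : e p + δ p = e q + δ q := hpq
    by_contra hne
    rcases lt_or_gt_of_ne (fun h => hne (he h)) with h | h
    · linarith [hi p q h, h0 q]
    · linarith [hi q p h, h0 p]
  rcases hc with hc | hc
  · obtain ⟨δ, h0, hs, hi, hz, hr⟩ := exists_shifts_of_pos hb hbt hc hcs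
    exact ⟨δ, fun p => mul_pos (h0 p) (hc p), hs, hinj hb h0 hi, hz, hr⟩
  -- Negative weights reduce to positive ones by the reflection z ↦ -z, since c/(b - z) = (-c)/((-b)
  -- - (-z)); the shifts change sign as well.
  · have hb' : Function.Injective fun p => - b p := neg_injective.comp hb
    obtain ⟨δ, h0, hs, hi, hz, hr⟩ := exists_shifts_of_pos (b := fun p => - b p)
      (c := fun p => - c p) hb' (by simpa using hbt)
      (fun p => neg_pos.2 (hc p)) hcs.neg
    have e1 : ∀ (x z : ℂ) (p : ι), x * (-(b p : ℂ) - -z)⁻¹ = -x * ((b p : ℂ) - z)⁻¹ := by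
      intro x z p
      rw [show -(b p : ℂ) - -z = -((b p : ℂ) - z) by ring, inv_neg]
      ring
    refine ⟨fun p => - δ p, fun p => by nlinarith [mul_pos (h0 p) (neg_pos.2 (hc p))], hs.neg,
      fun p q hpq => hinj hb' h0 hi ?_, fun z hne => ?_, fun q => ?_⟩
    · have hpq : b p + -δ p = b q + -δ q := hpq
      change - b p + δ p = - b q + δ q
      linarith
    · have h := hz (-z) fun p h => hne p (by simpa using h)
      simp only [Complex.ofReal_neg, e1, neg_neg] at h ⊢
      exact h
    · have h := hr q
      simp only [Complex.ofReal_neg, e1] at h ⊢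
      linear_combination -h

/-! ### Canonical products and the constant A -/

/-- The leading coefficient of `factor`: `a - z = scale a * factor a z`. -/
def scale (a : ℝ) : ℂ := if a = 0 then -1 else a

theorem scale_ne_zero (a : ℝ) : scale a ≠ 0 := by
  unfold scale
  split_ifs with h
  · simp
  · exact_mod_cast h

theorem scale_mul_factor (a : ℝ) (z : ℂ) : scale a * factor a z = a - z := by
  unfold scale factor
  split_ifs with h
  · simp [h]
  · have : (a : ℂ) ≠ 0 := by exact_mod_cast h
    field_simp

theorem factor_eq_zero_iff (a : ℝ) (z : ℂ) : factor a z = 0 ↔ (a : ℂ) = z := by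
  rw [← sub_eq_zero (a := (a : ℂ)), ← scale_mul_factor, mul_eq_zero, or_iff_right (scale_ne_zero a)]

theorem summable_norm_factor_sub_one {ι : Type*} {a : ι → ℝ} (ha : Summable fun p => (a p)⁻¹)
    (h0 : {p | a p = 0}.Finite) (z : ℂ) : Summable fun p => ‖factor (a p) z - 1‖ := by
  have h1 : Summable fun p => ‖z‖ * ‖(a p)⁻¹‖ := ha.norm.mul_left _
  refine h1.congr_cofinite ?_
  have : ∀ᶠ p in cofinite, a p ≠ 0 := by
    rw [eventually_cofinite]; simpa using h0
  filter_upwards [this] with p hp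
  rw [factor, if_neg hp, sub_sub_cancel_left, norm_neg, norm_div, Complex.norm_real, norm_inv,
    div_eq_mul_inv]

theorem multipliable_factor {ι : Type*} {a : ι → ℝ} (ha : Summable fun p => (a p)⁻¹)
    (h0 : {p | a p = 0}.Finite) (z : ℂ) : Multipliable fun p => factor (a p) z := by
  simpa using multipliable_one_add_of_summable (summable_norm_factor_sub_one ha h0 z)

theorem tprod_factor_ne_zero {ι : Type*} {a : ι → ℝ} (ha : Summable fun p => (a p)⁻¹)
    (h0 : {p | a p = 0}.Finite) {z : ℂ} (hz : ∀ p, (a p : ℂ) ≠ z) :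
    ∏' p, factor (a p) z ≠ 0 := by
  have := tprod_one_add_ne_zero_of_summable (f := fun p => factor (a p) z - 1)
    (fun p => by simpa [factor_eq_zero_iff] using hz p) (summable_norm_factor_sub_one ha h0 z)
  simpa using this

theorem summable_inv_add {ι : Type*} {b δ : ι → ℝ} (hbt : Tendsto (fun p => |b p|) cofinite atTop)
    (hb : Summable fun p => (b p)⁻¹) (hδ : Summable δ) : Summable fun p => (b p + δ p)⁻¹ := by
  refine Summable.of_norm_bounded_eventually (hb.norm.mul_left 2) ?_
  have h1 : ∀ᶠ p in cofinite, |δ p| < 1 := by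
    simpa using hδ.tendsto_cofinite_zero.abs.eventually_lt_const (show |(0 : ℝ)| < 1 by simp)
  filter_upwards [h1, hbt.eventually_ge_atTop 2] with p hp1 hp2
  have h3 : |b p| / 2 ≤ |b p + δ p| := by
    have := abs_sub_abs_le_abs_sub (b p) (-δ p)
    rw [abs_neg, sub_neg_eq_add] at this
    linarith
  rw [norm_inv, norm_inv, Real.norm_eq_abs, Real.norm_eq_abs]
  calc |b p + δ p|⁻¹ ≤ (|b p| / 2)⁻¹ := inv_anti₀ (by linarith) h3
    _ = 2 * |b p|⁻¹ := by rw [inv_div]; ring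

/-- Zeros, poles, residues and the factorization of `1 + ∑ c / (b - z)`. -/
theorem exists_factorization {ι : Type*} {b c : ι → ℝ} (hb : Function.Injective b)
    (hbt : Tendsto (fun p => |b p|) cofinite atTop) (hbs : Summable fun p => (b p)⁻¹)
    (hc : (∀ p, 0 < c p) ∨ ∀ p, c p < 0) (hcs : Summable c) :
    ∃ (m : ι → ℝ) (A : ℂ), Function.Injective m ∧ (∀ p, 0 < (m p - b p) * c p) ∧
      (∀ p q, m p ≠ b q) ∧
      (∀ z : ℂ, (∀ p, (b p : ℂ) ≠ z) →
        (1 + ∑' p, (c p : ℂ) * ((b p : ℂ) - z)⁻¹ = 0 ↔ ∃ p, (m p : ℂ) = z)) ∧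
      (Summable fun p => (m p)⁻¹) ∧ A ≠ 0 ∧
      (∀ z : ℂ, (∀ p, (b p : ℂ) ≠ z) →
        A * ∏' p, factor (m p) z =
          (1 + ∑' p, (c p : ℂ) * ((b p : ℂ) - z)⁻¹) * ∏' p, factor (b p) z) ∧
      ∀ q, A * scale (b q) * ∏' p, factor (m p) (b q) =
        c q * ∏' p : ({q}ᶜ : Set ι), factor (b p) (b q) := by
  classical
  obtain ⟨δ, hδc, hδs, hinj, hz, hr⟩ := exists_shifts hb hbt hc hcs
  have hbf : {p | b p = 0}.Finite := Set.Subsingleton.finite fun p hp q hq => hb (hp.trans hq.symm)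
  have hmf : {p | b p + δ p = 0}.Finite :=
    Set.Subsingleton.finite fun p hp q hq => hinj (hp.trans hq.symm)
  have hms := summable_inv_add hbt hbs hδs
  have hδ0 : ∀ p, δ p ≠ 0 := fun p h => by have := hδc p; simp [h] at this
  have hc0 : ∀ p, c p ≠ 0 := fun p h => by have := hδc p; simp [h] at this
  have hsn := fun z => summable_norm_mul_of_tendsto_cofinite hδs (tendsto_inv_sub_cofinite hbt z)
  have hmul := fun z => multipliable_one_add_of_summable (hsn z)
  -- A zero at the pole `b q` would annihilate a factor of the product in the residue identity at
  -- `q`, whose value is `c q ≠ 0`.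
  have hmb : ∀ p q, b p + δ p ≠ b q := by
    intro p q h
    have hpq : p ≠ q := by
      rintro rfl
      exact hδ0 p (by linarith)
    have h0 : ∃ p, 1 + (δ p : ℂ) * ((b p : ℂ) - b q)⁻¹ = 0 := by
      refine ⟨p, ?_⟩
      have h1 : (b p : ℂ) - b q ≠ 0 := by
        rw [sub_ne_zero]
        exact_mod_cast fun h' => hpq (hb h')
      have h2 : (b p : ℂ) + δ p = b q := by exact_mod_cast h
      field_simp
      linear_combination h2
    have h1 := hr q
    rw [tprod_of_exists_eq_zero h0, mul_zero] at h1
    exact hc0 q (by exact_mod_cast h1.symm)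
  -- The constant A is the product of these ratios of leading coefficients. It converges because the
  -- ratio is 1 + δ/b except where `b p` or `b p + δ p` is zero.
  set r : ι → ℂ := fun p => scale (b p + δ p) / scale (b p) with hrdef
  have hrs : Summable fun p => ‖r p - 1‖ := by
    refine (hsn 0).congr_cofinite ?_
    have h1 : ∀ᶠ p in cofinite, b p ≠ 0 := by rw [eventually_cofinite]; simpa using hbf
    have h2 : ∀ᶠ p in cofinite, b p + δ p ≠ 0 := by rw [eventually_cofinite]; simpa using hmf
    filter_upwards [h1, h2] with p hp1 hp2
    have : (b p : ℂ) ≠ 0 := by exact_mod_cast hp1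
    simp only [hrdef, scale, if_neg hp1, if_neg hp2]
    congr 1
    push_cast
    rw [sub_zero]
    field_simp
    ring
  have hrm : Multipliable r := by simpa using multipliable_one_add_of_summable hrs
  have hA : ∏' p, r p ≠ 0 := by
    have := tprod_one_add_ne_zero_of_summable (f := fun p => r p - 1)
      (fun p => by rw [add_sub_cancel]; exact div_ne_zero (scale_ne_zero _) (scale_ne_zero _)) hrs
    simpa using this
  refine ⟨fun p => b p + δ p, ∏' p, r p, hinj, fun p => by simpa using hδc p, hmb,
    fun z hzb => ?_, hms, hA, fun z hzb => ?_, fun q => ?_⟩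
  · rw [← hz z hzb]
    have hfac : ∀ p, 1 + (δ p : ℂ) * ((b p : ℂ) - z)⁻¹ = 0 ↔ ((b p + δ p : ℝ) : ℂ) = z := by
      intro p
      have : (b p : ℂ) - z ≠ 0 := sub_ne_zero.2 (hzb p)
      have e : 1 + (δ p : ℂ) * ((b p : ℂ) - z)⁻¹ = ((b p + δ p : ℝ) - z) / ((b p : ℂ) - z) := by
        push_cast; field_simp; ring
      rw [e, div_eq_zero_iff, or_iff_left this, sub_eq_zero]
    constructor
    · intro h
      by_contra! hcon
      exact tprod_one_add_ne_zero_of_summable (fun p h' => hcon p ((hfac p).1 h')) (hsn z) h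
    · rintro ⟨p, hp⟩
      exact tprod_of_exists_eq_zero ⟨p, (hfac p).2 hp⟩
  · rw [← hz z hzb, ← hrm.tprod_mul (multipliable_factor hms hmf z),
      ← (hmul z).tprod_mul (multipliable_factor hbs hbf z)]
    refine tprod_congr fun p => ?_
    have h1 := scale_mul_factor (b p + δ p) z
    have h2 := scale_mul_factor (b p) z
    have h3 : (b p : ℂ) - z ≠ 0 := sub_ne_zero.2 (hzb p)
    have h4 := scale_ne_zero (b p)
    simp only [hrdef]
    rw [div_mul_eq_mul_div, div_eq_iff h4, h1]
    calc ((b p + δ p : ℝ) : ℂ) - z = (1 + (δ p : ℂ) * ((b p : ℂ) - z)⁻¹) * ((b p : ℂ) - z) := by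
          push_cast; field_simp; ring
      _ = _ := by rw [← h2]; ring
  · have hmi : Multipliable fun p => ({q}ᶜ : Set ι).mulIndicator (fun p => factor (b p) (b q)) p := by
      rw [← multipliable_subtype_iff_mulIndicator]
      exact multipliable_factor (a := fun p : ({q}ᶜ : Set ι) => b p) (hbs.subtype _)
        (Set.Subsingleton.finite fun p hp q hq => Subtype.ext (hb (hp.trans hq.symm))) _
    -- The index `q` contributes only δ q / scale (b q), the value of r q · φ_{b q + δ q}(b q).
    -- Isolating it in a one-term product allows all products to be compared index by index.
    have hsing : HasProd (fun p => if p = q then (δ q : ℂ) / scale (b q) else 1)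
        (δ q / scale (b q)) := by
      simpa using hasProd_ite_eq q ((δ q : ℂ) / scale (b q))
    have key : (∏' p, r p) * ∏' p, factor (b p + δ p) (b q) =
        (δ q / scale (b q)) * ((∏' p, (1 + (δ p : ℂ) * ((b p : ℂ) - b q)⁻¹)) *
          ∏' p, ({q}ᶜ : Set ι).mulIndicator (fun p => factor (b p) (b q)) p) := by
      rw [← hsing.tprod_eq, ← hrm.tprod_mul (multipliable_factor hms hmf _),
        ← (hmul _).tprod_mul hmi, ← hsing.multipliable.tprod_mul ((hmul _).mul hmi)]
      refine tprod_congr fun p => ?_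
      have h1 := scale_mul_factor (b p + δ p) (b q)
      have h4 := scale_ne_zero (b p)
      simp only [hrdef]
      rw [div_mul_eq_mul_div, div_eq_iff h4, h1]
      by_cases hpq : p = q
      · subst hpq
        simp only [sub_self, inv_zero, mul_zero, add_zero, one_mul, if_true]
        rw [Set.mulIndicator_of_notMem (by simp)]
        push_cast
        field_simp
        ring
      · rw [if_neg hpq, Set.mulIndicator_of_mem (by simpa using hpq)]
        have h2 := scale_mul_factor (b p) (b q)
        have h3 : (b p : ℂ) - b q ≠ 0 := by
          rw [sub_ne_zero]
          exact_mod_cast fun h' => hpq (hb h')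
        calc ((b p + δ p : ℝ) : ℂ) - b q
            = (1 + (δ p : ℂ) * ((b p : ℂ) - b q)⁻¹) * ((b p : ℂ) - b q) := by
              push_cast; field_simp; ring
          _ = _ := by rw [← h2]; ring
    rw [tprod_subtype ({q}ᶜ : Set ι) (fun p => factor (b p) (b q)), ← hr q, mul_right_comm, key]
    have h4 := scale_ne_zero (b q)
    field_simp

/-! ### Residues determined by a counted spectrum -/

/-- The poles are real, so each inverse is at most 1/y in norm and dominated convergence applies.
This limit normalizes A. -/
theorem tendsto_tsum_imaginary {ι : Type*} {c : ι → ℝ} (b : ι → ℝ) (hc : Summable c) :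
    Tendsto (fun y : ℝ => 1 + ∑' p, (c p : ℂ) * ((b p : ℂ) - Complex.I * y)⁻¹) atTop (𝓝 1) := by
  have hle : ∀ (p : ι) {y : ℝ}, 0 < y → ‖((b p : ℂ) - Complex.I * y)⁻¹‖ ≤ y⁻¹ := by
    intro p y hy
    rw [norm_inv]
    refine inv_anti₀ hy ?_
    have h := Complex.abs_im_le_norm ((b p : ℂ) - Complex.I * y)
    simpa [abs_of_pos hy] using h
  have h : Tendsto (fun y : ℝ => ∑' p, (c p : ℂ) * ((b p : ℂ) - Complex.I * y)⁻¹) atTop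
      (𝓝 (∑' _ : ι, (0 : ℂ))) := by
    refine tendsto_tsum_of_dominated_convergence hc.norm (fun p => ?_) ?_
    · rw [← mul_zero (c p : ℂ)]
      refine tendsto_const_nhds.mul (squeeze_zero_norm' ?_ tendsto_inv_atTop_zero)
      filter_upwards [eventually_gt_atTop 0] with y hy using hle p hy
    · filter_upwards [eventually_ge_atTop 1] with y hy p
      rw [norm_mul, Complex.norm_real]
      refine mul_le_of_le_one_right (norm_nonneg _) ((hle p (by linarith)).trans ?_)
      exact inv_le_one_of_one_le₀ hy
  simpa using h.const_add 1

theorem tprod_of_eq_range {ι : Type*} {T : Set ℝ} {m : ι → ℝ} (hT : T = Set.range m)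
    (hm : Function.Injective m) (f : ℝ → ℂ) : ∏' x : T, f x = ∏' p, f (m p) := by
  subst hT
  exact ((Equiv.ofInjective m hm).tprod_eq fun x => f x).symm

theorem multipliable_of_eq_range {ι : Type*} {T : Set ℝ} {m : ι → ℝ} (hT : T = Set.range m)
    (hm : Function.Injective m) {f : ℝ → ℂ} (h : Multipliable fun p => f (m p)) :
    Multipliable fun x : T => f x := by
  subst hT
  exact (Equiv.ofInjective m hm).multipliable_iff (f := fun x : Set.range m => f x) |>.1 h

theorem multipliable_factor_range {ι : Type*} {T : Set ℝ} {m : ι → ℝ} (hT : T = Set.range m)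
    (hm : Function.Injective m) (hs : Summable fun p => (m p)⁻¹) (z : ℂ) :
    Multipliable fun x : T => factor x z :=
  multipliable_of_eq_range hT hm (f := fun x => factor x z) (multipliable_factor hs
    (Set.Subsingleton.finite fun _ hp _ hq => hm (Eq.trans hp (Eq.symm hq))) z)

theorem tendsto_abs_four_mul_sq : Tendsto (fun p : ℕ => |4 * (p : ℝ) ^ 2|) cofinite atTop := by
  rw [Nat.cofinite_eq_atTop]
  refine tendsto_atTop_mono (fun p => ?_) (tendsto_natCast_atTop_atTop (R := ℝ))
  rw [abs_of_nonneg (by positivity)]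
  rcases Nat.eq_zero_or_pos p with h | h
  · simp [h]
  · have : (1 : ℝ) ≤ p := by exact_mod_cast h
    nlinarith

theorem four_mul_sq_injective : Function.Injective fun p : ℕ => 4 * (p : ℝ) ^ 2 := by
  intro p q h
  have h1 : (p : ℝ) ^ 2 = (q : ℝ) ^ 2 := by
    have h : 4 * (p : ℝ) ^ 2 = 4 * (q : ℝ) ^ 2 := h
    linarith
  have h2 : (p : ℝ) = q := (sq_eq_sq₀ (by positivity) (by positivity)).1 h1
  exact_mod_cast h2

theorem summable_inv_four_mul_sq : Summable fun p : ℕ => (4 * (p : ℝ) ^ 2)⁻¹ := by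
  simp only [mul_inv]
  exact (Real.summable_nat_pow_inv.2 (by norm_num)).mul_left _

/-- The poles and zeros of `1 + ∑ r_p / (4p² - z)` in terms of `lost` and `gained`. -/
theorem exists_gained_param {S : Set (ℂ × ℕ)} {r : ℕ → ℝ} (hr : Summable r)
    (hsign : (∀ p, 0 ≤ r p) ∨ ∀ p, r p ≤ 0)
    (hlost : ∀ x, x ∈ lost S ↔ ∃ p : ℕ, r p ≠ 0 ∧ x = 4 * (p : ℝ) ^ 2)
    (hgained : ∀ x, x ∈ gained S ↔ x ∉ lost S ∧
      1 + ∑' p, (r p : ℂ) * (((4 * (p : ℝ) ^ 2 : ℝ) : ℂ) - x)⁻¹ = 0) :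
    ∃ (m : {p // r p ≠ 0} → ℝ) (A : ℂ), Function.Injective m ∧
      (∀ p, 0 < (m p - 4 * (p : ℝ) ^ 2) * r p) ∧ gained S = Set.range m ∧
      (Summable fun p => (m p)⁻¹) ∧ A ≠ 0 ∧
      (∀ z : ℂ, (∀ p : {p // r p ≠ 0}, ((4 * (p : ℝ) ^ 2 : ℝ) : ℂ) ≠ z) →
        A * ∏' p, factor (m p) z =
          (1 + ∑' p : {p // r p ≠ 0}, (r p : ℂ) * (((4 * (p : ℝ) ^ 2 : ℝ) : ℂ) - z)⁻¹) *
            ∏' p : {p // r p ≠ 0}, factor (4 * (p : ℝ) ^ 2) z) ∧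
      ∀ q : {p // r p ≠ 0},
        A * scale (4 * (q : ℝ) ^ 2) * ∏' p, factor (m p) ((4 * (q : ℝ) ^ 2 : ℝ) : ℂ) =
        r q * ∏' p : ({q}ᶜ : Set {p // r p ≠ 0}),
          factor (4 * (p : ℝ) ^ 2) ((4 * (q : ℝ) ^ 2 : ℝ) : ℂ) := by
  -- Restricting to the actual poles makes the sign strict. If all `r p` vanish the index type is
  -- empty and the products are 1, so this case needs no separate treatment.
  have hsign' : (∀ p : {p // r p ≠ 0}, 0 < r p) ∨ ∀ p : {p // r p ≠ 0}, r p < 0 :=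
    hsign.imp (fun h p => (h p).lt_of_ne' p.2) fun h p => (h p).lt_of_ne p.2
  obtain ⟨m, A, hm, hmc, hmb, hz, hms, hA, hprod, hres⟩ :=
    exists_factorization (b := fun p : {p // r p ≠ 0} => 4 * ((p : ℕ) : ℝ) ^ 2)
      (c := fun p => r p) (four_mul_sq_injective.comp Subtype.val_injective)
      (tendsto_abs_four_mul_sq.comp Subtype.val_injective.tendsto_cofinite)
      (summable_inv_four_mul_sq.subtype {p | r p ≠ 0}) hsign' (hr.subtype {p | r p ≠ 0})
  refine ⟨m, A, hm, hmc, ?_, hms, hA, hprod, hres⟩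
  have hsum : ∀ x : ℝ, ∑' p, (r p : ℂ) * (((4 * (p : ℝ) ^ 2 : ℝ) : ℂ) - x)⁻¹ =
      ∑' p : {p // r p ≠ 0}, (r p : ℂ) * (((4 * (p : ℝ) ^ 2 : ℝ) : ℂ) - x)⁻¹ := by
    intro x
    refine (tsum_subtype_eq_of_support_subset (s := {p | r p ≠ 0})
      (f := fun p : ℕ => (r p : ℂ) * (((4 * (p : ℝ) ^ 2 : ℝ) : ℂ) - x)⁻¹) ?_).symm
    intro p hp h0
    simp [h0] at hp
  ext x
  rw [hgained, hlost, hsum]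
  constructor
  · rintro ⟨h1, h2⟩
    obtain ⟨p, hp⟩ := (hz x fun p hp => h1 ⟨p, p.2, by exact_mod_cast hp.symm⟩).1 h2
    exact ⟨p, by exact_mod_cast hp⟩
  · rintro ⟨p, rfl⟩
    have h1 : ¬ ∃ q : ℕ, r q ≠ 0 ∧ m p = 4 * (q : ℝ) ^ 2 := by
      rintro ⟨q, hq, h⟩
      exact hmb p ⟨q, hq⟩ h
    exact ⟨h1, (hz (m p) fun q hq => hmb p q (by exact_mod_cast hq.symm)).2 ⟨p, rfl⟩⟩

theorem lost_eq_range {S : Set (ℂ × ℕ)} {r : ℕ → ℝ}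
    (hlost : ∀ x, x ∈ lost S ↔ ∃ p : ℕ, r p ≠ 0 ∧ x = 4 * (p : ℝ) ^ 2) :
    lost S = Set.range fun p : {p // r p ≠ 0} => 4 * ((p : ℕ) : ℝ) ^ 2 := by
  ext x
  rw [hlost]
  constructor
  · rintro ⟨p, hp, rfl⟩
    exact ⟨⟨p, hp⟩, rfl⟩
  · rintro ⟨p, rfl⟩
    exact ⟨p, p.2, rfl⟩

/-- Dividing A ∏ φ_μ = F ∏ φ_a by A ∏ φ_a at z = iy and using F(iy) → 1 gives the limit for 1/A. The
residue form of the factorization, solved for `r p`, is the product formula. -/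
theorem givenByProducts_of_lost_gained {S : Set (ℂ × ℕ)} {r : ℕ → ℝ} (hr : Summable r)
    (hsign : (∀ p, 0 ≤ r p) ∨ ∀ p, r p ≤ 0)
    (hlost : ∀ x, x ∈ lost S ↔ ∃ p : ℕ, r p ≠ 0 ∧ x = 4 * (p : ℝ) ^ 2)
    (hgained : ∀ x, x ∈ gained S ↔ x ∉ lost S ∧
      1 + ∑' p, (r p : ℂ) * (((4 * (p : ℝ) ^ 2 : ℝ) : ℂ) - x)⁻¹ = 0) :
    GivenByProducts S r := by
  classical
  obtain ⟨m, A, hm, -, hG, hms, hA, hprod, hres⟩ := exists_gained_param hr hsign hlost hgained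
  have hL := lost_eq_range hlost
  set b : {p // r p ≠ 0} → ℝ := fun p => 4 * ((p : ℕ) : ℝ) ^ 2 with hb
  have hbi : Function.Injective b := four_mul_sq_injective.comp Subtype.val_injective
  have hbs : Summable fun p => (b p)⁻¹ := summable_inv_four_mul_sq.subtype {p | r p ≠ 0}
  have hb0 : {p | b p = 0}.Finite :=
    Set.Subsingleton.finite fun _ hp _ hq => hbi (Eq.trans hp (Eq.symm hq))
  refine ⟨multipliable_factor_range hG hm hms, multipliable_factor_range hL hbi hbs,
    fun z p => ?_, A, hA, ?_, fun p => ?_⟩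
  · refine multipliable_factor_range (m := fun q : b ⁻¹' {4 * (p : ℝ) ^ 2}ᶜ => b q) ?_
      (hbi.comp Subtype.val_injective) (hbs.subtype _) z
    rw [hL]
    ext x
    constructor
    · rintro ⟨⟨q, rfl⟩, hq⟩
      exact ⟨⟨q, hq⟩, rfl⟩
    · rintro ⟨⟨q, hq⟩, rfl⟩
      exact ⟨⟨q, rfl⟩, hq⟩
  · have h1 := (tendsto_tsum_imaginary b (hr.subtype {p | r p ≠ 0})).mul_const A⁻¹
    rw [one_mul] at h1
    refine h1.congr' ?_
    filter_upwards [eventually_gt_atTop 0] with y hy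
    have hne : ∀ p, (b p : ℂ) ≠ Complex.I * y := by
      intro p h
      have := congrArg Complex.im h
      simp at this
      exact hy.ne this
    rw [tprod_of_eq_range hG hm (fun x => factor x (Complex.I * y)),
      tprod_of_eq_range hL hbi (fun x => factor x (Complex.I * y)),
      eq_div_iff (tprod_factor_ne_zero hbs hb0 hne)]
    have h2 := hprod (Complex.I * y) hne
    have h3 : ∏' p, factor (m p) (Complex.I * y) =
        A⁻¹ * (A * ∏' p, factor (m p) (Complex.I * y)) := by
      rw [← mul_assoc, inv_mul_cancel₀ hA, one_mul]
    rw [h3, h2]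
    simp only [hb, Function.comp_apply]
    exact (mul_right_comm _ _ _).trans (mul_comm _ _)
  · unfold residueProduct
    by_cases hp : r p = 0
    · rw [if_neg, hp, Complex.ofReal_zero]
      rw [hlost]
      rintro ⟨q, hq, h⟩
      exact hq (four_mul_sq_injective h ▸ hp)
    · rw [if_pos ((hlost _).2 ⟨p, hp, rfl⟩)]
      have h1 := hres ⟨p, hp⟩
      have h2 : lost S \ {4 * (p : ℝ) ^ 2} =
          Set.range fun q : ({⟨p, hp⟩}ᶜ : Set {p // r p ≠ 0}) => b q := by
        rw [hL]
        ext x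
        constructor
        · rintro ⟨⟨q, rfl⟩, hq⟩
          refine ⟨⟨q, fun h => hq ?_⟩, rfl⟩
          rw [Set.mem_singleton_iff] at h ⊢
          rw [h]
        · rintro ⟨⟨q, hq⟩, rfl⟩
          exact ⟨⟨q, rfl⟩, fun h => hq (hbi (h : b q = b ⟨p, hp⟩))⟩
      have hinj : Function.Injective fun q : ({⟨p, hp⟩}ᶜ : Set {p // r p ≠ 0}) => b q :=
        hbi.comp Subtype.val_injective
      have e : (4 * (p : ℂ) ^ 2) = ((4 * (p : ℝ) ^ 2 : ℝ) : ℂ) := by push_cast; rfl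
      -- The factor κ_p is the leading coefficient `scale` at the pole 4p²; its value -1 at p = 0
      -- comes from φ₀(z) = z.
      have hscale : (if p = 0 then -1 else 4 * (p : ℂ) ^ 2) = scale (4 * (p : ℝ) ^ 2) := by
        unfold scale
        by_cases h0 : p = 0
        · simp [h0]
        · rw [if_neg h0, if_neg (by positivity), e]
      rw [hscale, e, tprod_of_eq_range hG hm (fun x => factor x ((4 * (p : ℝ) ^ 2 : ℝ) : ℂ)),
        tprod_of_eq_range h2 hinj (fun x => factor x ((4 * (p : ℝ) ^ 2 : ℝ) : ℂ)), eq_div_iff]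
      · exact h1.symm
      · refine tprod_factor_ne_zero (hbs.subtype _)
          (Set.Subsingleton.finite fun _ hp _ hq => hinj (Eq.trans hp (Eq.symm hq))) fun q h => ?_
        have h : b q = b ⟨p, hp⟩ := Complex.ofReal_injective h
        exact q.2 (hbi h)

/-- Each zero lies to the right of its own pole when the residues are positive, so the least pole
precedes every zero. -/
theorem exists_lost_lt_gained {S : Set (ℂ × ℕ)} {r : ℕ → ℝ} (hr : Summable r)
    (hsign : ∀ p, 0 ≤ r p) (hne : ∃ p, r p ≠ 0)
    (hlost : ∀ x, x ∈ lost S ↔ ∃ p : ℕ, r p ≠ 0 ∧ x = 4 * (p : ℝ) ^ 2)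
    (hgained : ∀ x, x ∈ gained S ↔ x ∉ lost S ∧
      1 + ∑' p, (r p : ℂ) * (((4 * (p : ℝ) ^ 2 : ℝ) : ℂ) - x)⁻¹ = 0) :
    ∃ a ∈ lost S, ∀ m ∈ gained S, a < m := by
  classical
  obtain ⟨m, A, hm, hmc, hG, -⟩ := exists_gained_param hr (.inl hsign) hlost hgained
  refine ⟨4 * ((Nat.find hne : ℕ) : ℝ) ^ 2, (hlost _).2 ⟨_, Nat.find_spec hne, rfl⟩, ?_⟩
  rw [hG]
  rintro _ ⟨p, rfl⟩
  have h1 : ((Nat.find hne : ℕ) : ℝ) ≤ (p : ℕ) := by exact_mod_cast Nat.find_min' hne p.2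
  have h2 : 4 * ((Nat.find hne : ℕ) : ℝ) ^ 2 ≤ 4 * ((p : ℕ) : ℝ) ^ 2 := by gcongr
  have h3 := (pos_iff_pos_of_mul_pos (hmc p)).2 ((hsign p).lt_of_ne' p.2)
  linarith

/-- With negative residues the zero attached to the least pole lies to its left, hence below every
pole. -/
theorem exists_gained_lt_lost {S : Set (ℂ × ℕ)} {r : ℕ → ℝ} (hr : Summable r)
    (hsign : ∀ p, r p ≤ 0) (hne : ∃ p, r p ≠ 0)
    (hlost : ∀ x, x ∈ lost S ↔ ∃ p : ℕ, r p ≠ 0 ∧ x = 4 * (p : ℝ) ^ 2)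
    (hgained : ∀ x, x ∈ gained S ↔ x ∉ lost S ∧
      1 + ∑' p, (r p : ℂ) * (((4 * (p : ℝ) ^ 2 : ℝ) : ℂ) - x)⁻¹ = 0) :
    ∃ m ∈ gained S, ∀ a ∈ lost S, m < a := by
  classical
  obtain ⟨m, A, hm, hmc, hG, -⟩ := exists_gained_param hr (.inr hsign) hlost hgained
  have hq := Nat.find_spec hne
  refine ⟨m ⟨Nat.find hne, hq⟩, hG ▸ ⟨_, rfl⟩, fun a ha => ?_⟩
  obtain ⟨p, hp, rfl⟩ := (hlost a).1 ha
  have h1 : ((Nat.find hne : ℕ) : ℝ) ≤ (p : ℕ) := by exact_mod_cast Nat.find_min' hne hp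
  have h2 : 4 * ((Nat.find hne : ℕ) : ℝ) ^ 2 ≤ 4 * ((p : ℕ) : ℝ) ^ 2 := by gcongr
  have h3 := hmc ⟨Nat.find hne, hq⟩
  have h4 : r (Nat.find hne) < 0 := (hsign _).lt_of_ne hq
  have h5 := neg_of_mul_pos_left h3 h4.le
  simp only at h5
  linarith

/-- Uniqueness of limits fixes A, after which the right-hand side depends on `S` alone. -/
theorem GivenByProducts.unique {S : Set (ℂ × ℕ)} {r r' : ℕ → ℝ} (h : GivenByProducts S r)
    (h' : GivenByProducts S r') : r = r' := by
  obtain ⟨-, -, -, A, hA, hlim, hr⟩ := h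
  obtain ⟨-, -, -, A', hA', hlim', hr'⟩ := h'
  have hAA : A = A' := inv_injective (tendsto_nhds_unique hlim hlim')
  subst hAA
  funext p
  exact_mod_cast (hr p).trans (hr' p).symm

/-! ### Integration by parts and the periodic eigenfunctions -/

theorem pi_mem_Icc : Real.pi ∈ Set.Icc 0 Real.pi := ⟨Real.pi_pos.le, le_rfl⟩

theorem integral_mu_eq (f : ℝ → ℂ) : ∫ x, f x ∂mu = ∫ x in (0 : ℝ)..Real.pi, f x :=
  (intervalIntegral.integral_of_le Real.pi_pos.le).symm

theorem coeFn_ofContinuous (f : ℝ → ℂ) (hf : Continuous f) :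
    (ofContinuous f hf : ℝ → ℂ) =ᵐ[mu] f := MemLp.coeFn_toLp _

theorem integral_congr_mu {f g : ℝ → ℂ} (h : f =ᵐ[mu] g) {x : ℝ} (hx : x ∈ Set.Icc 0 Real.pi) :
    ∫ t in (0 : ℝ)..x, f t = ∫ t in (0 : ℝ)..x, g t := by
  refine intervalIntegral.integral_congr_ae ?_
  filter_upwards [(ae_restrict_iff' measurableSet_Ioc).1 h] with t ht hm
  rw [Set.uIoc_of_le hx.1] at hm
  exact ht ⟨hm.1, hm.2.trans hx.2⟩

/-- Fubini on the triangle 0 < t ≤ x ≤ π. This yields integration by parts for a merely integrable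
`f`, with no pointwise derivative of its primitive. -/
theorem integral_mul_primitive_aux {E' f : ℝ → ℂ} (hE' : Continuous E')
    (hf : IntervalIntegrable f volume 0 Real.pi) :
    ∫ x in (0 : ℝ)..Real.pi, E' x * ∫ t in (0 : ℝ)..x, f t =
      ∫ t in (0 : ℝ)..Real.pi, f t * ∫ x in t..Real.pi, E' x := by
  have hf' : Integrable f mu := (intervalIntegrable_iff_integrableOn_Ioc_of_le Real.pi_pos.le).1 hf
  have hE'' : Integrable E' mu := (intervalIntegrable_iff_integrableOn_Ioc_of_le Real.pi_pos.le).1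
    (hE'.intervalIntegrable 0 Real.pi)
  have hmeas : MeasurableSet {p : ℝ × ℝ | p.2 ≤ p.1} := measurableSet_le measurable_snd measurable_fst
  have hint : Integrable (Function.uncurry fun x t : ℝ =>
      {p : ℝ × ℝ | p.2 ≤ p.1}.indicator (fun p => E' p.1 * f p.2) (x, t)) (mu.prod mu) :=
    (hE''.mul_prod hf').indicator hmeas
  have h := integral_integral_swap hint
  rw [intervalIntegral.integral_of_le Real.pi_pos.le, intervalIntegral.integral_of_le Real.pi_pos.le]
  refine Eq.trans (setIntegral_congr_fun measurableSet_Ioc fun x hx => ?_)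
    (h.trans (setIntegral_congr_fun measurableSet_Ioc fun t ht => ?_))
  · rw [intervalIntegral.integral_of_le hx.1.le, ← integral_const_mul]
    have e : (fun t : ℝ => {p : ℝ × ℝ | p.2 ≤ p.1}.indicator (fun p => E' p.1 * f p.2) (x, t)) =
        (Set.Iic x).indicator fun t => E' x * f t := by
      funext t
      simp [Set.indicator]
    rw [e, integral_indicator measurableSet_Iic, Measure.restrict_restrict measurableSet_Iic]
    congr 2
    ext t
    simp only [Set.mem_Ioc, Set.mem_inter_iff, Set.mem_Iic]
    constructor
    · rintro ⟨h1, h2⟩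
      exact ⟨h2, h1, h2.trans hx.2⟩
    · rintro ⟨h1, h2, h3⟩
      exact ⟨h2, h1⟩
  -- The slice of the triangle is [t, π], closed at t, hence the change from the half-open interval.
  · rw [intervalIntegral.integral_of_le ht.2, ← integral_const_mul, ← integral_Icc_eq_integral_Ioc (x := t)]
    have e : (fun x : ℝ => {p : ℝ × ℝ | p.2 ≤ p.1}.indicator (fun p => E' p.1 * f p.2) (x, t)) =
        (Set.Ici t).indicator fun x => f t * E' x := by
      funext x
      simp [Set.indicator, mul_comm]
    rw [e, integral_indicator measurableSet_Ici, Measure.restrict_restrict measurableSet_Ici]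
    congr 2
    ext x
    simp only [Set.mem_Ioc, Set.mem_inter_iff, Set.mem_Ici, Set.mem_Icc]
    constructor
    · rintro ⟨h1, h2, h3⟩
      exact ⟨h1, h3⟩
    · rintro ⟨h1, h2⟩
      exact ⟨h1, ht.1.trans_le h1, h2⟩

/-- Integration by parts for a `C¹` function and the primitive of an integrable function. -/
theorem integral_mul_primitive {E E' F f : ℝ → ℂ} (hE : ∀ x, HasDerivAt E (E' x) x)
    (hE' : Continuous E') (hf : IntervalIntegrable f volume 0 Real.pi)
    (hF : ∀ x ∈ Set.Icc 0 Real.pi, F x = F 0 + ∫ t in (0 : ℝ)..x, f t) :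
    ∫ x in (0 : ℝ)..Real.pi, E x * f x =
      E Real.pi * F Real.pi - E 0 * F 0 - ∫ x in (0 : ℝ)..Real.pi, E' x * F x := by
  have hEc : Continuous E := continuous_iff_continuousAt.2 fun x => (hE x).continuousAt
  have hint : ∀ a b : ℝ, ∫ x in a..b, E' x = E b - E a := fun a b =>
    intervalIntegral.integral_eq_sub_of_hasDerivAt (fun x _ => hE x) (hE'.intervalIntegrable _ _)
  have hprim : ContinuousOn (fun x => ∫ t in (0 : ℝ)..x, f t) (Set.uIcc 0 Real.pi) :=
    intervalIntegral.continuousOn_primitive_interval ((intervalIntegrable_iff').1 hf)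
  have h1 : ∫ x in (0 : ℝ)..Real.pi, E' x * F x =
      (∫ x in (0 : ℝ)..Real.pi, E' x * F 0) +
        ∫ x in (0 : ℝ)..Real.pi, E' x * ∫ t in (0 : ℝ)..x, f t := by
    rw [← intervalIntegral.integral_add]
    · refine intervalIntegral.integral_congr fun x hx => ?_
      rw [Set.uIcc_of_le Real.pi_pos.le] at hx
      rw [hF x hx]
      ring
    · exact (hE'.mul continuous_const).intervalIntegrable _ _
    · exact (hE'.continuousOn.mul hprim).intervalIntegrable
  have h2 : ∫ t in (0 : ℝ)..Real.pi, f t * ∫ x in t..Real.pi, E' x =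
      (∫ t in (0 : ℝ)..Real.pi, E Real.pi * f t) - ∫ t in (0 : ℝ)..Real.pi, E t * f t := by
    rw [← intervalIntegral.integral_sub (hf.const_mul _) (hf.continuousOn_mul hEc.continuousOn)]
    refine intervalIntegral.integral_congr fun x _ => ?_
    rw [hint]
    ring
  rw [h1, integral_mul_primitive_aux hE' hf, h2, intervalIntegral.integral_mul_const, hint,
    intervalIntegral.integral_const_mul, hF Real.pi pi_mem_Icc]
  ring

/-- `E` is a smooth solution of `-E'' = l E` with periodic boundary conditions. -/
structure IsPeriodicSolution (E E₁ : ℝ → ℂ) (l : ℂ) : Prop where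
  deriv : ∀ x, HasDerivAt E (E₁ x) x
  deriv₁ : ∀ x, HasDerivAt E₁ (-l * E x) x
  periodic : E 0 = E Real.pi
  periodic₁ : E₁ 0 = E₁ Real.pi

namespace IsPeriodicSolution

variable {E E₁ : ℝ → ℂ} {l : ℂ}

theorem continuous (h : IsPeriodicSolution E E₁ l) : Continuous E :=
  continuous_iff_continuousAt.2 fun x => (h.deriv x).continuousAt

theorem continuous₁ (h : IsPeriodicSolution E E₁ l) : Continuous E₁ :=
  continuous_iff_continuousAt.2 fun x => (h.deriv₁ x).continuousAt

/-- Two integrations by parts move the second derivative onto `E`; periodicity of both functions and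
of their derivatives cancels the boundary terms. -/
theorem integral_mul (h : IsPeriodicSolution E E₁ l) {p : H × H} (hp : p ∈ graphL0) :
    ∫ x in (0 : ℝ)..Real.pi, E x * p.2 x = l * ∫ x in (0 : ℝ)..Real.pi, E x * p.1 x := by
  obtain ⟨Y, Y₁, hW, hb, hb₁⟩ := hp
  have h1 := integral_mul_primitive h.deriv h.continuous₁ (intervalIntegrable_coe (-p.2) pi_mem_Icc)
    hW.2.2
  have h2 := integral_mul_primitive h.deriv₁ (h.continuous.const_mul _ |>.congr fun x => rfl)
    (hW.intervalIntegrable pi_mem_Icc) hW.2.1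
  rw [h2, ← h.periodic, ← h.periodic₁, ← hb, ← hb₁] at h1
  have h3 : ∫ x in (0 : ℝ)..Real.pi, E x * (-p.2 : H) x =
      -∫ x in (0 : ℝ)..Real.pi, E x * p.2 x := by
    rw [← intervalIntegral.integral_neg]
    refine integral_congr_mu ?_ pi_mem_Icc
    filter_upwards [Lp.coeFn_neg p.2] with x hx
    rw [hx, Pi.neg_apply, mul_neg]
  have h4 : ∫ x in (0 : ℝ)..Real.pi, -l * E x * Y x =
      -l * ∫ x in (0 : ℝ)..Real.pi, E x * p.1 x := by
    rw [← intervalIntegral.integral_const_mul]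
    refine integral_congr_mu ?_ pi_mem_Icc
    filter_upwards [hW.1] with x hx
    rw [hx, mul_assoc]
  rw [h3, h4] at h1
  linear_combination -h1

theorem mem_graphL0 (h : IsPeriodicSolution E E₁ l) :
    ((ofContinuous E h.continuous : H), (l • ofContinuous E h.continuous : H)) ∈ graphL0 := by
  refine ⟨E, E₁, ⟨coeFn_ofContinuous E h.continuous, fun x _ => ?_, fun x hx => ?_⟩, h.periodic, h.periodic₁⟩
  · rw [intervalIntegral.integral_eq_sub_of_hasDerivAt (fun x _ => h.deriv x)
      (h.continuous₁.intervalIntegrable _ _)]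
    ring
  · have e : ∫ t in (0 : ℝ)..x, (-(l • ofContinuous E h.continuous) : H) t =
        ∫ t in (0 : ℝ)..x, -l * E t := by
      refine integral_congr_mu ?_ hx
      filter_upwards [Lp.coeFn_neg (l • ofContinuous E h.continuous),
        Lp.coeFn_smul l (ofContinuous E h.continuous), coeFn_ofContinuous E h.continuous]
        with t h1 h2 h3
      rw [h1, Pi.neg_apply, h2, Pi.smul_apply, h3, smul_eq_mul, neg_mul]
    change E₁ x = E₁ 0 + ∫ t in (0 : ℝ)..x, (-(l • ofContinuous E h.continuous) : H) t
    rw [e, intervalIntegral.integral_eq_sub_of_hasDerivAt (fun x _ => h.deriv₁ x)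
      ((h.continuous.const_mul _).intervalIntegrable _ _)]
    ring

end IsPeriodicSolution

/-- The normalizing factor of `cosVec`. -/
def amp (k : ℕ) : ℝ := if k = 0 then 1 / √Real.pi else √(2 / Real.pi)

theorem amp_pos (k : ℕ) : 0 < amp k := by
  have := Real.pi_pos
  unfold amp
  split_ifs <;> positivity

theorem cosVec_apply_eq (k : ℕ) (x : ℝ) : (if k = 0 then 1 / √Real.pi
    else √(2 / Real.pi) * Real.cos (2 * k * x) : ℝ) = amp k * Real.cos (2 * k * x) := by
  unfold amp
  split_ifs with h
  · simp [h]
  · rfl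

theorem hasDerivAt_two_mul (k : ℕ) (x : ℝ) :
    HasDerivAt (fun y : ℝ => 2 * (k : ℝ) * y) (2 * k) x := by
  simpa using (hasDerivAt_id' x).const_mul (2 * (k : ℝ))

theorem isPeriodicSolution_cos (k : ℕ) : IsPeriodicSolution
    (fun x => ((if k = 0 then 1 / √Real.pi
      else √(2 / Real.pi) * Real.cos (2 * k * x) : ℝ) : ℂ))
    (fun x => ((-(amp k * (2 * k) * Real.sin (2 * k * x)) : ℝ) : ℂ)) (4 * (k : ℂ) ^ 2) := by
  simp only [cosVec_apply_eq]
  refine ⟨fun x => ?_, fun x => ?_, ?_, ?_⟩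
  · refine HasDerivAt.ofReal_comp ?_
    have h := ((hasDerivAt_two_mul k x).cos).const_mul (amp k)
    exact h.congr_deriv (by ring)
  · have h := (((hasDerivAt_two_mul k x).sin).const_mul
      (-(amp k * (2 * k)))).ofReal_comp
    convert h using 1
    · funext y
      push_cast
      ring
    · push_cast
      ring
  · rw [show 2 * (k : ℝ) * Real.pi = k * (2 * Real.pi) by ring, Real.cos_nat_mul_two_pi]
    simp
  · rw [show 2 * (k : ℝ) * Real.pi = (2 * k : ℕ) * Real.pi by push_cast; ring, Real.sin_nat_mul_pi]
    simp

theorem isPeriodicSolution_sin (k : ℕ) : IsPeriodicSolution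
    (fun x => ((√(2 / Real.pi) * Real.sin (2 * k * x) : ℝ) : ℂ))
    (fun x => ((√(2 / Real.pi) * (2 * k) * Real.cos (2 * k * x) : ℝ) : ℂ)) (4 * (k : ℂ) ^ 2) := by
  refine ⟨fun x => ?_, fun x => ?_, ?_, ?_⟩
  · refine HasDerivAt.ofReal_comp ?_
    have h := ((hasDerivAt_two_mul k x).sin).const_mul (√(2 / Real.pi))
    exact h.congr_deriv (by ring)
  · have h := (((hasDerivAt_two_mul k x).cos).const_mul
      (√(2 / Real.pi) * (2 * k))).ofReal_comp
    convert h using 1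
    push_cast
    ring
  · rw [show 2 * (k : ℝ) * Real.pi = (2 * k : ℕ) * Real.pi by push_cast; ring, Real.sin_nat_mul_pi]
    simp
  · rw [show 2 * (k : ℝ) * Real.pi = k * (2 * Real.pi) by ring, Real.cos_nat_mul_two_pi]
    simp

/-! ### The trigonometric system: completeness and orthonormality -/

theorem inner_ofContinuous_ofReal (f : ℝ → ℝ) (hf : Continuous fun x => (f x : ℂ)) (g : H) :
    inner ℂ (ofContinuous (fun x => (f x : ℂ)) hf) g =
      ∫ x in (0 : ℝ)..Real.pi, (f x : ℂ) * g x := by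
  rw [L2.inner_def, ← integral_mu_eq]
  refine integral_congr_ae ?_
  filter_upwards [coeFn_ofContinuous _ hf] with x hx
  rw [hx, RCLike.inner_apply, Complex.conj_ofReal, mul_comm]

theorem inner_ofContinuous_ofContinuous (f g : ℝ → ℝ) (hf : Continuous fun x => (f x : ℂ))
    (hg : Continuous fun x => (g x : ℂ)) :
    inner ℂ (ofContinuous (fun x => (f x : ℂ)) hf) (ofContinuous (fun x => (g x : ℂ)) hg) =
      ((∫ x in (0 : ℝ)..Real.pi, f x * g x : ℝ) : ℂ) := by
  rw [inner_ofContinuous_ofReal, ← intervalIntegral.integral_ofReal]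
  refine integral_congr_mu ?_ pi_mem_Icc
  filter_upwards [coeFn_ofContinuous _ hg] with x hx
  rw [hx, Complex.ofReal_mul]

theorem c_eq_integral (k : ℕ) (g : H) :
    c k g = ∫ x in (0 : ℝ)..Real.pi, ((amp k * Real.cos (2 * k * x) : ℝ) : ℂ) * g x := by
  rw [c, cosVec, inner_ofContinuous_ofReal]
  simp only [cosVec_apply_eq]

theorem s_eq_integral (k : ℕ) (g : H) :
    s k g = ∫ x in (0 : ℝ)..Real.pi, ((√(2 / Real.pi) * Real.sin (2 * k * x) : ℝ) : ℂ) * g x := by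
  rw [s, sinVec, inner_ofContinuous_ofReal]

theorem c_snd_of_mem_graphL0 (k : ℕ) {p : H × H} (hp : p ∈ graphL0) :
    c k p.2 = 4 * (k : ℂ) ^ 2 * c k p.1 := by
  rw [c, c, cosVec, inner_ofContinuous_ofReal, inner_ofContinuous_ofReal]
  exact (isPeriodicSolution_cos k).integral_mul hp

theorem s_snd_of_mem_graphL0 (k : ℕ) {p : H × H} (hp : p ∈ graphL0) :
    s k p.2 = 4 * (k : ℂ) ^ 2 * s k p.1 := by
  rw [s, s, sinVec, inner_ofContinuous_ofReal, inner_ofContinuous_ofReal]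
  exact (isPeriodicSolution_sin k).integral_mul hp

theorem cosVec_mem_graphL0 (k : ℕ) : (cosVec k, (4 * (k : ℂ) ^ 2) • cosVec k) ∈ graphL0 :=
  (isPeriodicSolution_cos k).mem_graphL0

theorem sinVec_mem_graphL0 (k : ℕ) : (sinVec k, (4 * (k : ℂ) ^ 2) • sinVec k) ∈ graphL0 :=
  (isPeriodicSolution_sin k).mem_graphL0

/-- Completeness of the trigonometric system. -/
theorem eq_zero_of_coeff_eq_zero {f : H} (hc : ∀ k, c k f = 0) (hs : ∀ k, s k f = 0) : f = 0 := by
  have hcos : ∀ k : ℕ, ∫ x in (0 : ℝ)..Real.pi, (Real.cos (2 * k * x) : ℂ) * f x = 0 := by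
    intro k
    have h := hc k
    rw [c_eq_integral] at h
    simp only [Complex.ofReal_mul (amp k), mul_assoc] at h
    rw [intervalIntegral.integral_const_mul, mul_eq_zero] at h
    have h' := h.resolve_left (by exact_mod_cast (amp_pos k).ne')
    simpa only [mul_assoc] using h'
  have hsin : ∀ k : ℕ, ∫ x in (0 : ℝ)..Real.pi, (Real.sin (2 * k * x) : ℂ) * f x = 0 := by
    intro k
    have h := hs k
    rw [s_eq_integral] at h
    simp only [Complex.ofReal_mul (√(2 / Real.pi)), mul_assoc] at h
    rw [intervalIntegral.integral_const_mul, mul_eq_zero] at h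
    have := Real.pi_pos
    have h' := h.resolve_left (by
      have : √(2 / Real.pi) ≠ 0 := by positivity
      exact_mod_cast this)
    simpa only [mul_assoc] using h'
  have hfi := intervalIntegrable_coe f pi_mem_Icc
  -- Cosines and sines of 2|n|x recombine into the exponentials of period π, with the sign of n in
  -- front of the sine.
  have hexp : ∀ n : ℤ, ∫ x in (0 : ℝ)..Real.pi, Complex.exp (2 * n * x * Complex.I) * f x = 0 := by
    intro n
    have e : ∀ x : ℝ, Complex.exp (2 * n * x * Complex.I) * f x =
        (Real.cos (2 * n.natAbs * x) : ℂ) * f x +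
          (n.sign * Complex.I) * ((Real.sin (2 * n.natAbs * x) : ℂ) * f x) := by
      intro x
      have h1 : Complex.exp (2 * n * x * Complex.I) =
          (Real.cos (2 * n.natAbs * x) : ℂ) + n.sign * Complex.I * Real.sin (2 * n.natAbs * x) := by
        have h2 : (2 * n * x * Complex.I : ℂ) = ((2 * n * x : ℝ) : ℂ) * Complex.I := by push_cast; ring
        rw [h2, Complex.exp_mul_I, ← Complex.ofReal_cos, ← Complex.ofReal_sin]
        obtain ⟨m, rfl | rfl⟩ := n.eq_nat_or_neg
        · rcases Nat.eq_zero_or_pos m with h | h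
          · subst h; simp
          · rw [Int.natAbs_natCast, Int.sign_natCast_of_ne_zero h.ne']
            push_cast
            ring
        · rcases Nat.eq_zero_or_pos m with h | h
          · subst h; simp
          · rw [Int.natAbs_neg, Int.natAbs_natCast, Int.sign_neg,
              Int.sign_natCast_of_ne_zero h.ne',
              show (2 * ((-(m : ℤ) : ℤ) : ℝ) * x) = -(2 * m * x) by push_cast; ring,
              Real.cos_neg, Real.sin_neg]
            push_cast
            ring
      rw [h1]
      ring
    simp only [e]
    rw [intervalIntegral.integral_add, hcos, intervalIntegral.integral_const_mul, hsin]
    · simp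
    · exact hfi.continuousOn_mul (by fun_prop)
    · exact (hfi.continuousOn_mul (by fun_prop)).const_mul _
  have hcoef : ∀ n : ℤ, fourierCoeffOn Real.pi_pos f n = 0 := by
    intro n
    rw [fourierCoeffOn_eq_integral]
    have h := hexp (-n)
    have e : ∫ x in (0 : ℝ)..Real.pi, fourier (-n) (x : AddCircle (Real.pi - 0)) • f x =
        ∫ x in (0 : ℝ)..Real.pi, Complex.exp (2 * (-n : ℤ) * x * Complex.I) * f x := by
      refine intervalIntegral.integral_congr fun x _ => ?_
      rw [fourier_coe_apply, smul_eq_mul]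
      congr 2
      have : (Real.pi : ℂ) ≠ 0 := by exact_mod_cast Real.pi_ne_zero
      rw [sub_zero]
      field_simp
    rw [e, h, smul_zero]
  -- Parseval on (0, π) turns the vanishing of all coefficients into the vanishing of ∫ ‖f‖².
  have hP := hasSum_sq_fourierCoeffOn Real.pi_pos (Lp.memLp f)
  simp only [hcoef, norm_zero, ne_eq, OfNat.ofNat_ne_zero, not_false_eq_true, zero_pow] at hP
  have h0 := hP.unique hasSum_zero
  rw [smul_eq_mul, mul_eq_zero, sub_zero, inv_eq_zero] at h0
  have h1 := h0.resolve_left Real.pi_ne_zero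
  have h2 : inner ℂ f f = (0 : ℂ) := by
    rw [L2.inner_def]
    have e : ∀ x, inner ℂ (f x) (f x) = ((‖f x‖ ^ 2 : ℝ) : ℂ) := by
      intro x
      rw [inner_self_eq_norm_sq_to_K]
      push_cast
      rfl
    simp only [e]
    rw [integral_mu_eq, intervalIntegral.integral_ofReal, h1, Complex.ofReal_zero]
  exact inner_self_eq_zero.1 h2

theorem sq_cast_ne {j k : ℕ} (h : j ≠ k) : (4 * (k : ℂ) ^ 2) - 4 * (j : ℂ) ^ 2 ≠ 0 := by
  intro h0
  refine h (four_mul_sq_injective (show 4 * (j : ℝ) ^ 2 = 4 * (k : ℝ) ^ 2 from ?_))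
  exact_mod_cast (sub_eq_zero.1 h0).symm

theorem c_smul (k : ℕ) (a : ℂ) (f : H) : c k (a • f) = a * c k f := inner_smul_right _ _ _

theorem s_smul (k : ℕ) (a : ℂ) (f : H) : s k (a • f) = a * s k f := inner_smul_right _ _ _

theorem c_add (k : ℕ) (f g : H) : c k (f + g) = c k f + c k g := inner_add_right _ _ _

theorem s_add (k : ℕ) (f g : H) : s k (f + g) = s k f + s k g := inner_add_right _ _ _

theorem c_sub (k : ℕ) (f g : H) : c k (f - g) = c k f - c k g := inner_sub_right _ _ _

theorem s_sub (k : ℕ) (f g : H) : s k (f - g) = s k f - s k g := inner_sub_right _ _ _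

/-- Eigenvectors for distinct eigenvalues are orthogonal, so no trigonometric integral has to be
computed for j ≠ k. -/
theorem c_cosVec_of_ne {j k : ℕ} (h : j ≠ k) : c j (cosVec k) = 0 := by
  have h1 := c_snd_of_mem_graphL0 j (cosVec_mem_graphL0 k)
  simp only [c_smul] at h1
  exact (mul_eq_zero.1 (show (4 * (k : ℂ) ^ 2 - 4 * (j : ℂ) ^ 2) * c j (cosVec k) = 0 by
    linear_combination h1)).resolve_left (sq_cast_ne h)

theorem c_sinVec_of_ne {j k : ℕ} (h : j ≠ k) : c j (sinVec k) = 0 := by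
  have h1 := c_snd_of_mem_graphL0 j (sinVec_mem_graphL0 k)
  simp only [c_smul] at h1
  exact (mul_eq_zero.1 (show (4 * (k : ℂ) ^ 2 - 4 * (j : ℂ) ^ 2) * c j (sinVec k) = 0 by
    linear_combination h1)).resolve_left (sq_cast_ne h)

theorem s_cosVec_of_ne {j k : ℕ} (h : j ≠ k) : s j (cosVec k) = 0 := by
  have h1 := s_snd_of_mem_graphL0 j (cosVec_mem_graphL0 k)
  simp only [s_smul] at h1
  exact (mul_eq_zero.1 (show (4 * (k : ℂ) ^ 2 - 4 * (j : ℂ) ^ 2) * s j (cosVec k) = 0 by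
    linear_combination h1)).resolve_left (sq_cast_ne h)

theorem s_sinVec_of_ne {j k : ℕ} (h : j ≠ k) : s j (sinVec k) = 0 := by
  have h1 := s_snd_of_mem_graphL0 j (sinVec_mem_graphL0 k)
  simp only [s_smul] at h1
  exact (mul_eq_zero.1 (show (4 * (k : ℂ) ^ 2 - 4 * (j : ℂ) ^ 2) * s j (sinVec k) = 0 by
    linear_combination h1)).resolve_left (sq_cast_ne h)

theorem sin_two_mul_nat_mul_pi (k : ℕ) : Real.sin (2 * k * Real.pi) = 0 := by
  rw [show 2 * (k : ℝ) * Real.pi = (2 * k : ℕ) * Real.pi by push_cast; ring, Real.sin_nat_mul_pi]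

theorem cos_two_mul_nat_mul_pi (k : ℕ) : Real.cos (2 * k * Real.pi) = 1 := by
  rw [show 2 * (k : ℝ) * Real.pi = k * (2 * Real.pi) by ring, Real.cos_nat_mul_two_pi]

theorem hasDerivAt_sin_mul_cos (k : ℕ) (x : ℝ) :
    HasDerivAt (fun y => Real.sin (2 * k * y) * Real.cos (2 * k * y))
      (2 * k * Real.cos (2 * k * x) ^ 2 - 2 * k * Real.sin (2 * k * x) ^ 2) x :=
  ((hasDerivAt_two_mul k x).sin.mul (hasDerivAt_two_mul k x).cos).congr_deriv (by ring)

/-- The difference of the integrands is, up to the factor 2k, the derivative of sin · cos, which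
vanishes at both ends. Together with cos² + sin² = 1 this gives the normalization. -/
theorem integral_cos_sq_sub_sin_sq {k : ℕ} (hk : k ≠ 0) :
    (∫ x in (0 : ℝ)..Real.pi, Real.cos (2 * k * x) ^ 2) =
      ∫ x in (0 : ℝ)..Real.pi, Real.sin (2 * k * x) ^ 2 := by
  have h := intervalIntegral.integral_eq_sub_of_hasDerivAt (a := 0) (b := Real.pi)
    (fun x _ => hasDerivAt_sin_mul_cos k x)
    (Continuous.intervalIntegrable (by fun_prop) _ _)
  rw [sin_two_mul_nat_mul_pi, mul_zero, Real.sin_zero, zero_mul, zero_mul, sub_zero,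
    intervalIntegral.integral_sub (Continuous.intervalIntegrable (by fun_prop) _ _)
      (Continuous.intervalIntegrable (by fun_prop) _ _), intervalIntegral.integral_const_mul,
    intervalIntegral.integral_const_mul, ← mul_sub, mul_eq_zero] at h
  exact sub_eq_zero.1 (h.resolve_left (by positivity))

theorem integral_cos_sq_two_mul {k : ℕ} (hk : k ≠ 0) :
    ∫ x in (0 : ℝ)..Real.pi, Real.cos (2 * k * x) ^ 2 = Real.pi / 2 := by
  have h1 := integral_cos_sq_sub_sin_sq hk
  have h2 : (∫ x in (0 : ℝ)..Real.pi, Real.cos (2 * k * x) ^ 2) +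
      ∫ x in (0 : ℝ)..Real.pi, Real.sin (2 * k * x) ^ 2 = Real.pi := by
    rw [← intervalIntegral.integral_add (Continuous.intervalIntegrable (by fun_prop) _ _)
      (Continuous.intervalIntegrable (by fun_prop) _ _)]
    simp
  linarith

theorem integral_sin_sq_two_mul {k : ℕ} (hk : k ≠ 0) :
    ∫ x in (0 : ℝ)..Real.pi, Real.sin (2 * k * x) ^ 2 = Real.pi / 2 := by
  rw [← integral_cos_sq_sub_sin_sq hk, integral_cos_sq_two_mul hk]

theorem integral_cos_mul_sin (k : ℕ) :
    ∫ x in (0 : ℝ)..Real.pi, Real.cos (2 * k * x) * Real.sin (2 * k * x) = 0 := by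
  rcases eq_or_ne k 0 with rfl | hk
  · simp
  have h := intervalIntegral.integral_eq_sub_of_hasDerivAt (a := 0) (b := Real.pi)
    (f := fun x => Real.sin (2 * k * x) ^ 2)
    (fun x _ => ((hasDerivAt_two_mul k x).sin.pow 2).congr_deriv
      (show _ = (4 * k) * (Real.cos (2 * k * x) * Real.sin (2 * k * x)) by norm_num; ring))
    (Continuous.intervalIntegrable (by fun_prop) _ _)
  rw [sin_two_mul_nat_mul_pi, mul_zero, Real.sin_zero, intervalIntegral.integral_const_mul,
    sub_self, mul_eq_zero] at h
  exact h.resolve_left (by positivity)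

theorem c_cosVec_self (k : ℕ) : c k (cosVec k) = 1 := by
  have hpi := Real.pi_pos
  rw [c, cosVec, inner_ofContinuous_ofContinuous]
  simp only [cosVec_apply_eq]
  have e : ∀ x : ℝ, amp k * Real.cos (2 * k * x) * (amp k * Real.cos (2 * k * x)) =
      amp k ^ 2 * Real.cos (2 * k * x) ^ 2 := fun x => by ring
  simp only [e, intervalIntegral.integral_const_mul]
  rcases eq_or_ne k 0 with rfl | hk
  · have : amp 0 ^ 2 * Real.pi = 1 := by
      simp only [amp, if_true, div_pow, Real.sq_sqrt hpi.le]
      field_simp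
    simpa using by exact_mod_cast this
  · rw [integral_cos_sq_two_mul hk]
    have : amp k ^ 2 * (Real.pi / 2) = 1 := by
      rw [amp, if_neg hk, Real.sq_sqrt (by positivity)]
      field_simp
    rw [this, Complex.ofReal_one]

theorem s_sinVec_self {k : ℕ} (hk : k ≠ 0) : s k (sinVec k) = 1 := by
  have hpi := Real.pi_pos
  rw [s, sinVec, inner_ofContinuous_ofContinuous]
  have e : ∀ x : ℝ, √(2 / Real.pi) * Real.sin (2 * k * x) * (√(2 / Real.pi) * Real.sin (2 * k * x)) =
      √(2 / Real.pi) ^ 2 * Real.sin (2 * k * x) ^ 2 := fun x => by ring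
  simp only [e, intervalIntegral.integral_const_mul]
  rw [integral_sin_sq_two_mul hk, Real.sq_sqrt (by positivity)]
  have : 2 / Real.pi * (Real.pi / 2) = 1 := by field_simp
  rw [this, Complex.ofReal_one]

theorem c_sinVec_self (k : ℕ) : c k (sinVec k) = 0 := by
  rw [c, sinVec, cosVec, inner_ofContinuous_ofContinuous]
  simp only [cosVec_apply_eq]
  have e : ∀ x : ℝ, amp k * Real.cos (2 * k * x) * (√(2 / Real.pi) * Real.sin (2 * k * x)) =
      (amp k * √(2 / Real.pi)) * (Real.cos (2 * k * x) * Real.sin (2 * k * x)) := fun x => by ring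
  simp only [e, intervalIntegral.integral_const_mul]
  rw [integral_cos_mul_sin, mul_zero, Complex.ofReal_zero]

theorem s_cosVec_self (k : ℕ) : s k (cosVec k) = 0 := by
  rw [s, ← inner_conj_symm]
  change (starRingEnd ℂ) (c k (sinVec k)) = 0
  rw [c_sinVec_self, map_zero]

theorem sinVec_zero : sinVec 0 = 0 := by
  refine eq_zero_of_coeff_eq_zero (fun k => ?_) fun k => ?_
  · rcases eq_or_ne k 0 with rfl | h
    · exact c_sinVec_self 0
    · exact c_sinVec_of_ne h
  · rcases eq_or_ne k 0 with rfl | h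
    · rw [s, sinVec, inner_ofContinuous_ofContinuous]
      simp
    · exact s_sinVec_of_ne h

theorem s_zero_index (f : H) : s 0 f = 0 := by
  rw [s, sinVec_zero, inner_zero_left]

/-! ### Orthogonal decomposition into the spaces `G k` -/

theorem cosVec_mem (k : ℕ) : cosVec k ∈ G k := Submodule.subset_span (by simp)

theorem sinVec_mem (k : ℕ) : sinVec k ∈ G k := Submodule.subset_span (by simp)

/-- The orthogonal projection onto `G k`. -/
abbrev proj (k : ℕ) : H →L[ℂ] H := (G k).starProjection

theorem proj_mem (k : ℕ) (f : H) : proj k f ∈ G k := Submodule.starProjection_apply_mem _ _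

theorem inner_proj_right (k : ℕ) (f g : H) : inner ℂ f (proj k g) = inner ℂ (proj k f) g :=
  (Submodule.inner_starProjection_left_eq_right (G k) f g).symm

theorem proj_of_mem {k : ℕ} {f : H} (hf : f ∈ G k) : proj k f = f :=
  Submodule.starProjection_eq_self_iff.2 hf

theorem inner_proj_proj (k : ℕ) (f g : H) :
    inner ℂ (proj k f) (proj k g) = inner ℂ f (proj k g) := by
  rw [← inner_proj_right, proj_of_mem (proj_mem k g)]

theorem c_proj (k : ℕ) (f : H) : c k (proj k f) = c k f := by
  rw [c, inner_proj_right, proj_of_mem (cosVec_mem k), c]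

theorem s_proj (k : ℕ) (f : H) : s k (proj k f) = s k f := by
  rw [s, inner_proj_right, proj_of_mem (sinVec_mem k), s]

/-- The case k = 0 needs no exception: there the sine vector is zero. -/
theorem mem_G_iff {k : ℕ} {f : H} : f ∈ G k ↔ f = c k f • cosVec k + s k f • sinVec k := by
  constructor
  · intro hf
    obtain ⟨a, b, rfl⟩ := Submodule.mem_span_pair.1 hf
    rw [c_add, s_add, c_smul, c_smul, s_smul, s_smul, c_cosVec_self, c_sinVec_self, s_cosVec_self]
    rcases eq_or_ne k 0 with rfl | hk
    · simp [sinVec_zero]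
    · simp [s_sinVec_self hk]
  · intro h
    rw [h]
    exact (G k).add_mem ((G k).smul_mem _ (cosVec_mem k)) ((G k).smul_mem _ (sinVec_mem k))

theorem proj_eq (k : ℕ) (f : H) : proj k f = c k f • cosVec k + s k f • sinVec k := by
  have h := mem_G_iff.1 (proj_mem k f)
  rwa [c_proj, s_proj] at h

theorem normSqProj_eq (k : ℕ) (f : H) : normSqProj k f = ‖c k f‖ ^ 2 + ‖s k f‖ ^ 2 := by
  have h : (((‖proj k f‖ ^ 2 : ℝ)) : ℂ) = ((‖c k f‖ ^ 2 + ‖s k f‖ ^ 2 : ℝ) : ℂ) := by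
    have h1 := inner_self_eq_norm_sq_to_K (𝕜 := ℂ) (proj k f)
    push_cast
    refine h1.symm.trans ?_
    nth_rewrite 1 [proj_eq]
    rw [inner_add_left, inner_smul_left, inner_smul_left]
    change (starRingEnd ℂ) (c k f) * c k (proj k f) + (starRingEnd ℂ) (s k f) * s k (proj k f) = _
    rw [c_proj, s_proj, Complex.conj_mul', Complex.conj_mul']
  exact_mod_cast h

theorem isOrtho_G {j k : ℕ} (h : j ≠ k) : G j ⟂ G k := by
  rw [G, G, Submodule.isOrtho_span]
  intro u hu v hv
  simp only [Set.mem_insert_iff, Set.mem_singleton_iff] at hu hv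
  rcases hu with rfl | rfl <;> rcases hv with rfl | rfl
  · exact c_cosVec_of_ne h
  · exact c_sinVec_of_ne h
  · exact s_cosVec_of_ne h
  · exact s_sinVec_of_ne h

theorem orthogonalFamily_G : OrthogonalFamily ℂ (fun k => G k) fun k => (G k).subtypeₗᵢ :=
  OrthogonalFamily.of_pairwise fun _ _ h => isOrtho_G h

theorem proj_of_mem_of_ne {j k : ℕ} (h : j ≠ k) {f : H} (hf : f ∈ G k) : proj j f = 0 :=
  (Submodule.starProjection_apply_eq_zero_iff _).2 ((isOrtho_G h.symm).le hf)

theorem eq_of_proj_eq {f g : H} (h : ∀ k, proj k f = proj k g) : f = g := by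
  rw [← sub_eq_zero]
  refine eq_zero_of_coeff_eq_zero (fun k => ?_) fun k => ?_
  · rw [c_sub, ← c_proj, h, c_proj, sub_self]
  · rw [s_sub, ← s_proj, h, s_proj, sub_self]

theorem isHilbertSum_G : IsHilbertSum ℂ (fun k => G k) fun k => (G k).subtypeₗᵢ := by
  refine IsHilbertSum.mkInternal _ orthogonalFamily_G ?_
  rw [top_le_iff, Submodule.topologicalClosure_eq_top_iff, Submodule.eq_bot_iff]
  intro f hf
  rw [Submodule.mem_orthogonal] at hf
  exact eq_zero_of_coeff_eq_zero
    (fun k => hf _ (Submodule.mem_iSup_of_mem k (cosVec_mem k)))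
    fun k => hf _ (Submodule.mem_iSup_of_mem k (sinVec_mem k))

theorem proj_of_hasSum {w : ℕ → H} (hw : ∀ k, w k ∈ G k) {f : H} (h : HasSum w f) (k : ℕ) :
    proj k f = w k := by
  have h1 := h.mapL (proj k)
  have h2 : HasSum (fun j => proj k (w j)) (proj k (w k)) :=
    hasSum_single k fun j hj => proj_of_mem_of_ne hj.symm (hw j)
  rw [h1.unique h2, proj_of_mem (hw k)]

theorem hasSum_proj (f : H) : HasSum (fun k => proj k f) f := by
  have h := isHilbertSum_G.hasSum_linearIsometryEquiv_symm (isHilbertSum_G.linearIsometryEquiv f)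
  rw [LinearIsometryEquiv.symm_apply_apply] at h
  have e : (fun k => proj k f) = fun k => (G k).subtypeₗᵢ (isHilbertSum_G.linearIsometryEquiv f k) :=
    funext fun k => proj_of_hasSum (fun j => (isHilbertSum_G.linearIsometryEquiv f j).2) h k
  rw [e]
  exact h

theorem hasSum_inner_proj (f g : H) :
    HasSum (fun k => inner ℂ (proj k f) (proj k g)) (inner ℂ f g : ℂ) := by
  have h := (hasSum_proj g).mapL (innerSL ℂ f)
  simpa only [innerSL_apply_apply, inner_proj_proj] using h

theorem inner_proj_self (k : ℕ) (f : H) : inner ℂ (proj k f) (proj k f) = (normSqProj k f : ℂ) := by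
  rw [inner_self_eq_norm_sq_to_K, normSqProj]
  push_cast
  rfl

theorem hasSum_normSqProj (f : H) : HasSum (fun k => normSqProj k f) (‖f‖ ^ 2) := by
  have h := hasSum_inner_proj f f
  simp only [inner_proj_self] at h
  rw [inner_self_eq_norm_sq_to_K] at h
  have e : ((‖f‖ : ℂ)) ^ 2 = ((‖f‖ ^ 2 : ℝ) : ℂ) := by push_cast; rfl
  exact Complex.hasSum_ofReal.1 (e ▸ h)

theorem normSqProj_eq_zero_iff {k : ℕ} {f : H} : normSqProj k f = 0 ↔ proj k f = 0 := by
  rw [normSqProj, sq_eq_zero_iff, norm_eq_zero]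

theorem normSqProj_nonneg (k : ℕ) (f : H) : 0 ≤ normSqProj k f := sq_nonneg _

/-- Bounded multipliers with respect to the decomposition of `H` into the spaces `G k`. -/
theorem exists_proj_eq_smul {ρ : ℕ → ℂ} {M : ℝ} (hρ : ∀ k, ‖ρ k‖ ≤ M) (f : H) :
    ∃ g : H, ∀ k, proj k g = ρ k • proj k f := by
  have hs : Summable fun k => ρ k • proj k f := by
    have h := (orthogonalFamily_G.summable_iff_norm_sq_summable
      fun k => (⟨ρ k • proj k f, (G k).smul_mem _ (proj_mem k f)⟩ : G k)).2 ?_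
    · exact h
    · refine Summable.of_nonneg_of_le (fun k => sq_nonneg _) (fun k => ?_)
        ((hasSum_normSqProj f).summable.mul_left (M ^ 2))
      rw [normSqProj, ← mul_pow, Submodule.coe_norm, norm_smul]
      gcongr
      exact hρ k
  exact ⟨∑' k, ρ k • proj k f, fun k =>
    proj_of_hasSum (fun j => (G j).smul_mem _ (proj_mem j f)) hs.hasSum k⟩

/-! ### Diagonalization of `L0` -/

theorem smul_cosVec_zero_mem_graphL0 (a : ℂ) : (a • cosVec 0, (0 : H)) ∈ graphL0 := by
  have h := graphL0.smul_mem a (cosVec_mem_graphL0 0)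
  simpa using h

/-- The equation -y'' = g is solved by integrating twice. Zero mean of g makes y' periodic, and the
free constant in y' makes y periodic. -/
theorem exists_mem_graphL0 {g : H} (hg : c 0 g = 0) : ∃ y : H, (y, g) ∈ graphL0 := by
  have hg0 : ∫ x in (0 : ℝ)..Real.pi, g x = 0 := by
    rw [c_eq_integral] at hg
    simp only [Nat.cast_zero, mul_zero, zero_mul, Real.cos_zero, mul_one] at hg
    rw [intervalIntegral.integral_const_mul, mul_eq_zero] at hg
    exact hg.resolve_left (by exact_mod_cast (amp_pos 0).ne')
  -- Extension by zero makes the primitive continuous on the whole line.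
  set g₀ : ℝ → ℂ := (Set.Ioc 0 Real.pi).indicator g with hg₀
  have hint : Integrable g₀ volume := by
    rw [hg₀, integrable_indicator_iff measurableSet_Ioc]
    exact (Lp.memLp g).integrable (by norm_num)
  have hgg : ∀ x ∈ Set.Icc 0 Real.pi, ∫ t in (0 : ℝ)..x, g₀ t = ∫ t in (0 : ℝ)..x, g t := by
    intro x hx
    refine integral_congr_mu ?_ hx
    exact (ae_restrict_iff' measurableSet_Ioc).2 (Eventually.of_forall fun t ht => by
      rw [hg₀, Set.indicator_of_mem ht])
  set Q : ℝ → ℂ := fun x => ∫ t in (0 : ℝ)..x, g₀ t with hQ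
  have hQc : Continuous Q :=
    intervalIntegral.continuous_primitive (fun a b => hint.intervalIntegrable) 0
  -- The mean of `Q`, so that `C - Q` integrates to zero and Y(π) = Y(0).
  set C : ℂ := (Real.pi : ℂ)⁻¹ * ∫ x in (0 : ℝ)..Real.pi, Q x with hC
  set Y₁ : ℝ → ℂ := fun x => C - Q x with hY₁
  have hY₁c : Continuous Y₁ := continuous_const.sub hQc
  set Y : ℝ → ℂ := fun x => ∫ t in (0 : ℝ)..x, Y₁ t with hY
  have hYc : Continuous Y :=
    intervalIntegral.continuous_primitive (fun a b => hY₁c.intervalIntegrable a b) 0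
  have hpi : (Real.pi : ℂ) ≠ 0 := by exact_mod_cast Real.pi_ne_zero
  refine ⟨ofContinuous Y hYc, Y, Y₁, ⟨coeFn_ofContinuous Y hYc, fun x _ => ?_, fun x hx => ?_⟩,
    ?_, ?_⟩
  · simp [hY]
  · have e : ∫ t in (0 : ℝ)..x, (-g : H) t = -∫ t in (0 : ℝ)..x, g t := by
      rw [← intervalIntegral.integral_neg]
      refine integral_congr_mu ?_ hx
      filter_upwards [Lp.coeFn_neg g] with t ht
      rw [ht, Pi.neg_apply]
    change Y₁ x = Y₁ 0 + ∫ t in (0 : ℝ)..x, (-g : H) t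
    rw [e, ← hgg x hx]
    simp [hY₁, hQ, sub_eq_add_neg]
  · simp only [hY, intervalIntegral.integral_same, hY₁]
    rw [intervalIntegral.integral_sub intervalIntegrable_const (hQc.intervalIntegrable _ _),
      intervalIntegral.integral_const, hC]
    simp only [sub_zero, Complex.real_smul]
    field_simp
    ring
  · simp only [hY₁, hQ, intervalIntegral.integral_same]
    rw [hgg Real.pi pi_mem_Icc, hg0]

/-- For the converse, the condition at k = 0 says that g has zero mean, so some y' has image g. The
nonzero modes of y and y' then agree, and the remaining constant lies in the kernel. -/
theorem mem_graphL0_iff {y g : H} :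
    (y, g) ∈ graphL0 ↔ ∀ k, proj k g = (4 * (k : ℂ) ^ 2) • proj k y := by
  constructor
  · intro h k
    have h1 := c_snd_of_mem_graphL0 k h
    have h2 := s_snd_of_mem_graphL0 k h
    simp only at h1 h2
    rw [proj_eq, proj_eq, h1, h2, smul_add, smul_smul, smul_smul]
  · intro h
    have hc0 : c 0 g = 0 := by
      rw [← c_proj, h 0, c_smul]
      simp
    obtain ⟨y', hy'⟩ := exists_mem_graphL0 hc0
    have hk : ∀ k, k ≠ 0 → proj k (y - y') = 0 := by
      intro k hk
      have h1 := c_snd_of_mem_graphL0 k hy'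
      have h2 := s_snd_of_mem_graphL0 k hy'
      simp only at h1 h2
      have h3 : (4 * (k : ℂ) ^ 2) ≠ 0 := by
        have : (k : ℂ) ≠ 0 := by exact_mod_cast hk
        exact mul_ne_zero (by norm_num) (pow_ne_zero 2 this)
      have h4 : (4 * (k : ℂ) ^ 2) • proj k (y - y') = 0 := by
        rw [map_sub, smul_sub, ← h k, proj_eq, proj_eq, h1, h2, smul_add, smul_smul, smul_smul,
          sub_self]
      exact (smul_eq_zero.1 h4).resolve_left h3
    have h0 : y - y' = c 0 (y - y') • cosVec 0 := by
      refine ((hasSum_proj (y - y')).unique (hasSum_single 0 hk)).trans ?_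
      rw [proj_eq, sinVec_zero, smul_zero, add_zero]
    have h5 := graphL0.add_mem hy' (smul_cosVec_zero_mem_graphL0 (c 0 (y - y')))
    rw [← h0] at h5
    simpa using h5

/-! ### Eigenspaces of the rank-one perturbation -/

theorem mem_specSet_of_finrank_pos {T : H →ₗ.[ℂ] H} {z : ℂ}
    (h : 0 < Module.finrank ℂ (eigenspace T z)) : z ∈ specSet T := by
  rintro ⟨R, -, hR⟩
  have hnt : Nontrivial (eigenspace T z) := Module.nontrivial_of_finrank_pos h
  obtain ⟨y, hy⟩ := exists_ne (0 : eigenspace T z)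
  have h1 : T y.1 - z • (y.1 : H) = 0 := y.2
  have h2 := hR y.1
  rw [h1, map_zero] at h2
  exact hy (Subtype.ext (Subtype.ext h2.symm))

/-- An eigenspace of positive dimension puts its point in the spectrum, and a point carries only one
multiplicity. Comparison with `baseMult` is therefore a comparison of eigenspace dimensions. -/
theorem mem_lost_iff {T : H →ₗ.[ℂ] H} {x : ℝ} :
    x ∈ lost (countedSpectrum T) ↔ Module.finrank ℂ (eigenspace T x) < baseMult x := by
  constructor
  · rintro ⟨h0, h⟩
    by_contra hcon
    exact hcon (h _ ⟨mem_specSet_of_finrank_pos (h0.trans_le (not_lt.1 hcon)), rfl⟩)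
  · intro h
    refine ⟨(Nat.zero_le _).trans_lt h, ?_⟩
    rintro n ⟨-, hn⟩
    exact hn.trans_lt h

theorem mem_gained_iff {T : H →ₗ.[ℂ] H} {x : ℝ} :
    x ∈ gained (countedSpectrum T) ↔ baseMult x < Module.finrank ℂ (eigenspace T x) := by
  constructor
  · rintro ⟨n, ⟨-, hn⟩, h⟩
    exact h.trans_eq hn
  · intro h
    exact ⟨_, ⟨mem_specSet_of_finrank_pos ((Nat.zero_le _).trans_lt h), rfl⟩, h⟩

/-- The eigenspace of `L₀` at `z` in terms of the projections onto the spaces `G k`. -/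
def freeModes (z : ℂ) : Submodule ℂ H where
  carrier := {y | ∀ k : ℕ, (4 * (k : ℂ) ^ 2 - z) • proj k y = 0}
  zero_mem' k := by rw [map_zero, smul_zero]
  add_mem' hf hg k := by rw [map_add, smul_add, hf k, hg k, add_zero]
  smul_mem' a f hf k := by rw [map_smul, smul_comm, hf k, smul_zero]

/-- The eigenspace of `L(α, v)` at `z` in terms of the projections onto the spaces `G k`. -/
def perturbedModes (α : ℝ) (v : H) (z : ℂ) : Submodule ℂ H where
  carrier := {y | ∀ k : ℕ,
    (4 * (k : ℂ) ^ 2 - z) • proj k y + (α * inner ℂ v y) • proj k v = 0}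
  zero_mem' k := by simp
  add_mem' {f g} hf hg k := by
    have h1 := hf k
    have h2 := hg k
    rw [map_add, inner_add_right, smul_add, mul_add, add_smul]
    rw [add_add_add_comm, h1, h2, add_zero]
  smul_mem' a f hf k := by
    have h1 := hf k
    rw [map_smul, inner_smul_right, smul_comm, mul_left_comm, mul_smul, ← smul_add, h1, smul_zero]

/-- Read mode by mode through `mem_graphL0_iff`, the eigenvalue equation no longer involves the
domain. -/
theorem map_eigenspace (α : ℝ) (v : H) (z : ℂ) :
    (eigenspace (L α v) z).map (L α v).domain.subtype = perturbedModes α v z := by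
  ext y
  have hiff : y ∈ perturbedModes α v z ↔
      (y, z • y - ((α : ℂ) * inner ℂ v y) • v) ∈ graphL0 := by
    rw [mem_graphL0_iff]
    refine forall_congr' fun k => ?_
    rw [map_sub, map_smul, map_smul, sub_smul, ← sub_eq_zero (b := (4 * (k : ℂ) ^ 2) • proj k y),
      ← neg_eq_zero]
    refine Eq.congr ?_ rfl
    abel
  rw [hiff, ← graph_L0, LinearPMap.mem_graph_iff, Submodule.mem_map]
  have happ : ∀ w : L0.domain, (L α v) w - z • (w : H) = 0 ↔
      L0 w = z • (w : H) - ((α : ℂ) * inner ℂ v (w : H)) • v := by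
    intro w
    change L0 w + (α : ℂ) • (inner ℂ v (w : H) • v : H) - z • (w : H) = 0 ↔ _
    rw [smul_smul, sub_eq_zero, eq_sub_iff_add_eq]
  constructor
  · rintro ⟨w, hw, rfl⟩
    exact ⟨w, rfl, (happ w).1 hw⟩
  · rintro ⟨w, hw, hw'⟩
    simp only at hw hw'
    subst hw
    exact ⟨w, (happ w).2 hw', rfl⟩

theorem finrank_eigenspace (α : ℝ) (v : H) (z : ℂ) :
    Module.finrank ℂ (eigenspace (L α v) z) = Module.finrank ℂ (perturbedModes α v z) := by
  rw [← map_eigenspace]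
  exact (Submodule.equivMapOfInjective _ (Submodule.injective_subtype _) _).finrank_eq

theorem freeModes_eq_G (k : ℕ) : freeModes (4 * (k : ℂ) ^ 2) = G k := by
  ext y
  constructor
  · intro hy
    have h : proj k y = y := by
      refine ((hasSum_proj y).unique (hasSum_single k fun j hj => ?_)).symm
      exact (smul_eq_zero.1 (hy j)).resolve_left (sq_cast_ne hj.symm)
    rw [← h]
    exact proj_mem k y
  · intro hy j
    rcases eq_or_ne j k with rfl | hj
    · rw [sub_self, zero_smul]
    · rw [proj_of_mem_of_ne hj hy, smul_zero]

theorem freeModes_eq_bot {z : ℂ} (hz : ∀ k : ℕ, 4 * (k : ℂ) ^ 2 - z ≠ 0) : freeModes z = ⊥ := by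
  rw [Submodule.eq_bot_iff]
  intro y hy
  refine eq_of_proj_eq fun k => ?_
  rw [map_zero]
  exact (smul_eq_zero.1 (hy k)).resolve_left (hz k)

instance (z : ℂ) : FiniteDimensional ℂ (freeModes z) := by
  by_cases h : ∀ k : ℕ, 4 * (k : ℂ) ^ 2 - z ≠ 0
  · rw [freeModes_eq_bot h]
    infer_instance
  · push Not at h
    obtain ⟨k, hk⟩ := h
    rw [← sub_eq_zero.1 hk, freeModes_eq_G]
    infer_instance

theorem cosVec_ne_zero (k : ℕ) : cosVec k ≠ 0 := by
  intro h
  have h1 := c_cosVec_self k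
  rw [h, c, inner_zero_right] at h1
  exact zero_ne_one h1

theorem finrank_G_zero : Module.finrank ℂ (G 0) = 1 := by
  rw [G, sinVec_zero, Set.pair_comm, Submodule.span_insert_zero]
  exact finrank_span_singleton (cosVec_ne_zero 0)

theorem finrank_G {k : ℕ} (hk : k ≠ 0) : Module.finrank ℂ (G k) = 2 := by
  have hli : LinearIndependent ℂ ![cosVec k, sinVec k] := by
    rw [LinearIndependent.pair_iff]
    intro a b h
    have h1 := congrArg (c k) h
    have h2 := congrArg (s k) h
    rw [c_add, c_smul, c_smul, c_cosVec_self, c_sinVec_self] at h1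
    rw [s_add, s_smul, s_smul, s_cosVec_self, s_sinVec_self hk] at h2
    have h3 : c k 0 = 0 := inner_zero_right _
    have h4 : s k 0 = 0 := inner_zero_right _
    rw [h3] at h1
    rw [h4] at h2
    exact ⟨by simpa using h1, by simpa using h2⟩
  have h := finrank_span_eq_card hli
  rw [Fintype.card_fin] at h
  refine Eq.trans ?_ h
  rw [G, Matrix.range_cons, Matrix.range_cons, Matrix.range_empty, Set.union_empty,
    Set.singleton_union]

theorem finrank_freeModes (x : ℝ) : Module.finrank ℂ (freeModes x) = baseMult x := by
  by_cases h : ∃ k : ℕ, x = 4 * (k : ℝ) ^ 2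
  · obtain ⟨k, rfl⟩ := h
    have e : ((4 * (k : ℝ) ^ 2 : ℝ) : ℂ) = 4 * (k : ℂ) ^ 2 := by push_cast; rfl
    rw [e, freeModes_eq_G]
    rcases eq_or_ne k 0 with rfl | hk
    · rw [finrank_G_zero, baseMult, if_pos (by simp)]
    · rw [finrank_G hk, baseMult, if_neg (by positivity), if_pos ⟨k, rfl⟩]
  · rw [freeModes_eq_bot, finrank_bot, baseMult, if_neg, if_neg h]
    · rintro rfl
      exact h ⟨0, by simp⟩
    · intro k hk
      refine h ⟨k, ?_⟩
      have := (sub_eq_zero.1 hk).symm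
      exact_mod_cast this

/-- At a pole the p-th equation forces ⟨y, v⟩ = 0, so what remains are free modes. The free mode v_p
is not among them, since its inner product with v is ‖v_p‖² ≠ 0. -/
theorem perturbedModes_lt_freeModes {α : ℝ} {v : H} {p : ℕ} (hα : α ≠ 0) (hp : proj p v ≠ 0) :
    perturbedModes α v (4 * (p : ℂ) ^ 2) < freeModes (4 * (p : ℂ) ^ 2) := by
  have hα' : (α : ℂ) ≠ 0 := by exact_mod_cast hα
  have h0 : ∀ y ∈ perturbedModes α v (4 * (p : ℂ) ^ 2), (α : ℂ) * inner ℂ v y = 0 := by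
    intro y hy
    have h := hy p
    rw [sub_self, zero_smul, zero_add] at h
    exact (smul_eq_zero.1 h).resolve_right hp
  refine lt_of_le_of_ne (fun y hy k => ?_) fun heq => ?_
  · have h := hy k
    rwa [h0 y hy, zero_smul, add_zero] at h
  · have hmem : proj p v ∈ perturbedModes α v (4 * (p : ℂ) ^ 2) := by
      rw [heq, freeModes_eq_G]
      exact proj_mem p v
    have h1 := (mul_eq_zero.1 (h0 _ hmem)).resolve_left hα'
    rw [← inner_proj_proj] at h1
    exact hp (inner_self_eq_zero.1 h1)

/-- A resolvent vector: `(L₀ - x) K = α v` in every `G k`. -/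
theorem exists_resolvent_vector {α x : ℝ} {v : H}
    (h : ∀ p : ℕ, 4 * (p : ℂ) ^ 2 - x = 0 → (α : ℂ) • proj p v = 0) :
    ∃ K : H, (∀ p : ℕ, (4 * (p : ℂ) ^ 2 - x) • proj p K = (α : ℂ) • proj p v) ∧
      (∀ p : ℕ, (α : ℂ) • proj p v = 0 → proj p K = 0) ∧
      inner ℂ v K = ∑' p : ℕ, ((α * normSqProj p v : ℝ) : ℂ) *
        (((4 * (p : ℝ) ^ 2 : ℝ) : ℂ) - x)⁻¹ := by
  -- At an index with 4p² = x the multiplier is 0⁻¹ = 0, which is harmless because α v_p = 0 there;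
  -- so the multiplier is bounded for every x.
  obtain ⟨M, -, hM⟩ := exists_norm_le_of_tendsto_cofinite
    (tendsto_inv_sub_cofinite tendsto_abs_four_mul_sq x)
  obtain ⟨K, hK⟩ := exists_proj_eq_smul (ρ := fun p : ℕ => (((4 * (p : ℝ) ^ 2 : ℝ) : ℂ) - x)⁻¹)
    hM ((α : ℂ) • v)
  have e : ∀ p : ℕ, ((4 * (p : ℝ) ^ 2 : ℝ) : ℂ) = 4 * (p : ℂ) ^ 2 := fun p => by push_cast; rfl
  refine ⟨K, fun p => ?_, fun p hp => ?_, ?_⟩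
  · rw [hK p, map_smul]
    simp only [e]
    by_cases h0 : 4 * (p : ℂ) ^ 2 - x = 0
    · rw [h p h0, smul_zero, smul_zero]
    · rw [smul_inv_smul₀ h0]
  · rw [hK p, map_smul, hp, smul_zero]
  · rw [← (hasSum_inner_proj v K).tsum_eq]
    refine tsum_congr fun p => ?_
    rw [hK p, map_smul, inner_smul_right, inner_smul_right, inner_proj_self]
    push_cast
    ring

/-- A free mode lives only in the components with 4p² = x, and there α v_p vanishes. -/
theorem mul_inner_eq_zero_of_mem_freeModes {α x : ℝ} {v n : H}
    (h : ∀ p : ℕ, 4 * (p : ℂ) ^ 2 - x = 0 → (α : ℂ) • proj p v = 0) (hn : n ∈ freeModes x) :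
    (α : ℂ) * inner ℂ v n = 0 := by
  have h1 := (hasSum_inner_proj v n).mul_left (α : ℂ)
  refine h1.unique (hasSum_zero.congr_fun fun p => ?_)
  rcases smul_eq_zero.1 (hn p) with h0 | h0
  · have h2 := h p h0
    rcases smul_eq_zero.1 h2 with h3 | h3
    · rw [h3, zero_mul]
    · rw [h3, inner_zero_left, mul_zero]
  · rw [h0, inner_zero_right, mul_zero]

theorem freeModes_le_perturbedModes {α x : ℝ} {v : H}
    (h : ∀ p : ℕ, 4 * (p : ℂ) ^ 2 - x = 0 → (α : ℂ) • proj p v = 0) :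
    freeModes x ≤ perturbedModes α v x := by
  intro n hn k
  rw [mul_inner_eq_zero_of_mem_freeModes h hn, zero_smul, add_zero]
  exact hn k

/-- Since (L₀ - x) K = αv mode by mode, adding ⟨y, v⟩ K to y absorbs the rank-one term. -/
theorem mem_perturbedModes_iff {α x : ℝ} {v K y : H}
    (hK : ∀ p : ℕ, (4 * (p : ℂ) ^ 2 - x) • proj p K = (α : ℂ) • proj p v) :
    y ∈ perturbedModes α v x ↔ y + (inner ℂ v y : ℂ) • K ∈ freeModes x := by
  refine forall_congr' fun k => ?_
  rw [map_add, map_smul, smul_add, smul_comm _ (inner ℂ v y : ℂ), hK k, smul_smul,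
    mul_comm (α : ℂ)]

/-- Pairing the free mode y + ⟨y, v⟩ K with v gives α⟨y, v⟩ (1 + ⟨K, v⟩) = 0, so the perturbation
does not act on y. -/
theorem perturbedModes_eq_freeModes {α x : ℝ} {v K : H}
    (h : ∀ p : ℕ, 4 * (p : ℂ) ^ 2 - x = 0 → (α : ℂ) • proj p v = 0)
    (hK : ∀ p : ℕ, (4 * (p : ℂ) ^ 2 - x) • proj p K = (α : ℂ) • proj p v)
    (hF : 1 + inner ℂ v K ≠ (0 : ℂ)) : perturbedModes α v x = freeModes x := by
  refine le_antisymm (fun y hy k => ?_) (freeModes_le_perturbedModes h)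
  have h1 := mul_inner_eq_zero_of_mem_freeModes h ((mem_perturbedModes_iff hK).1 hy)
  rw [inner_add_right, inner_smul_right] at h1
  have h2 : ((α : ℂ) * inner ℂ v y) * (1 + inner ℂ v K) = 0 := by linear_combination h1
  have h3 := hy k
  rwa [(mul_eq_zero.1 h2).resolve_right hF, zero_smul, add_zero] at h3

/-- Now K itself is a perturbed mode. Were it free, every α v_p would vanish, hence K = 0,
contradicting ⟨K, v⟩ = -1. -/
theorem finrank_freeModes_lt {α x : ℝ} {v K : H}
    (h : ∀ p : ℕ, 4 * (p : ℂ) ^ 2 - x = 0 → (α : ℂ) • proj p v = 0)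
    (hK : ∀ p : ℕ, (4 * (p : ℂ) ^ 2 - x) • proj p K = (α : ℂ) • proj p v)
    (hK0 : ∀ p : ℕ, (α : ℂ) • proj p v = 0 → proj p K = 0)
    (hF : 1 + inner ℂ v K = (0 : ℂ)) :
    Module.finrank ℂ (freeModes x) < Module.finrank ℂ (perturbedModes α v x) := by
  -- Finite dimension must be secured first, because `finrank` is 0 on infinite-dimensional spaces.
  have hfin : FiniteDimensional ℂ (perturbedModes α v x) := by
    refine Submodule.finiteDimensional_of_le (S₂ := freeModes x ⊔ Submodule.span ℂ {K}) ?_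
    intro y hy
    have h1 := (mem_perturbedModes_iff hK).1 hy
    rw [← add_sub_cancel_right y ((inner ℂ v y : ℂ) • K), sub_eq_add_neg, ← neg_smul]
    exact Submodule.add_mem_sup h1 (Submodule.smul_mem _ _ (Submodule.mem_span_singleton_self K))
  refine Submodule.finrank_lt_finrank_of_lt
    (lt_of_le_of_ne (freeModes_le_perturbedModes h) fun heq => ?_)
  have hmem : K ∈ perturbedModes α v x := by
    rw [mem_perturbedModes_iff hK]
    have e : K + (inner ℂ v K : ℂ) • K = (1 + inner ℂ v K : ℂ) • K := by rw [add_smul, one_smul]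
    rw [e, hF, zero_smul]
    exact Submodule.zero_mem _
  rw [← heq] at hmem
  have hzero : K = 0 := by
    refine eq_of_proj_eq fun p => ?_
    rw [map_zero]
    exact hK0 p (by rw [← hK p, hmem p])
  rw [hzero, inner_zero_right, add_zero] at hF
  exact one_ne_zero hF

theorem mem_lost_countedSpectrum_iff {α : ℝ} {v : H} (x : ℝ) :
    x ∈ lost (countedSpectrum (L α v)) ↔ ∃ p : ℕ, α * normSqProj p v ≠ 0 ∧ x = 4 * (p : ℝ) ^ 2 := by
  rw [mem_lost_iff, finrank_eigenspace, ← finrank_freeModes]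
  constructor
  · intro hlt
    by_contra! hcon
    have h : ∀ p : ℕ, 4 * (p : ℂ) ^ 2 - x = 0 → (α : ℂ) • proj p v = 0 := by
      intro p hp
      have hx : x = 4 * (p : ℝ) ^ 2 := by exact_mod_cast (sub_eq_zero.1 hp).symm
      have h1 : α * normSqProj p v = 0 := by
        by_contra h1
        exact hcon p h1 hx
      rcases mul_eq_zero.1 h1 with h2 | h2
      · rw [h2, Complex.ofReal_zero, zero_smul]
      · rw [normSqProj_eq_zero_iff.1 h2, smul_zero]
    obtain ⟨K, hK, hK0, -⟩ := exists_resolvent_vector h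
    by_cases hF : 1 + inner ℂ v K = (0 : ℂ)
    · exact lt_asymm hlt (finrank_freeModes_lt h hK hK0 hF)
    · rw [perturbedModes_eq_freeModes h hK hF] at hlt
      exact lt_irrefl _ hlt
  · rintro ⟨p, hp, rfl⟩
    have e : ((4 * (p : ℝ) ^ 2 : ℝ) : ℂ) = 4 * (p : ℂ) ^ 2 := by push_cast; rfl
    rw [e]
    exact Submodule.finrank_lt_finrank_of_lt (perturbedModes_lt_freeModes (left_ne_zero_of_mul hp)
      fun h => right_ne_zero_of_mul hp (normSqProj_eq_zero_iff.2 h))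

theorem mem_gained_countedSpectrum_iff {α : ℝ} {v : H} (x : ℝ) :
    x ∈ gained (countedSpectrum (L α v)) ↔ x ∉ lost (countedSpectrum (L α v)) ∧
      1 + ∑' p : ℕ, ((α * normSqProj p v : ℝ) : ℂ) * (((4 * (p : ℝ) ^ 2 : ℝ) : ℂ) - x)⁻¹ = 0 := by
  by_cases hx : x ∈ lost (countedSpectrum (L α v))
  · refine iff_of_false (fun h => ?_) fun h => h.1 hx
    exact lt_asymm (mem_lost_iff.1 hx) (mem_gained_iff.1 h)
  have h : ∀ p : ℕ, 4 * (p : ℂ) ^ 2 - x = 0 → (α : ℂ) • proj p v = 0 := by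
    intro p hp
    have hx' : x = 4 * (p : ℝ) ^ 2 := by exact_mod_cast (sub_eq_zero.1 hp).symm
    have h1 : α * normSqProj p v = 0 := by
      by_contra h1
      exact hx ((mem_lost_countedSpectrum_iff x).2 ⟨p, h1, hx'⟩)
    rcases mul_eq_zero.1 h1 with h2 | h2
    · rw [h2, Complex.ofReal_zero, zero_smul]
    · rw [normSqProj_eq_zero_iff.1 h2, smul_zero]
  obtain ⟨K, hK, hK0, hKs⟩ := exists_resolvent_vector h
  rw [mem_gained_iff, finrank_eigenspace, ← finrank_freeModes, ← hKs, and_iff_right hx]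
  constructor
  · intro hlt
    by_contra hF
    rw [perturbedModes_eq_freeModes h hK hF] at hlt
    exact lt_irrefl _ hlt
  · exact finrank_freeModes_lt h hK hK0

/-! ### Product formulas and the sign of α -/

theorem mul_normSqProj_sign (α : ℝ) (v : H) :
    (∀ p, 0 ≤ α * normSqProj p v) ∨ ∀ p, α * normSqProj p v ≤ 0 := by
  rcases le_total 0 α with h | h
  · exact .inl fun p => mul_nonneg h (normSqProj_nonneg p v)
  · exact .inr fun p => mul_nonpos_of_nonpos_of_nonneg h (normSqProj_nonneg p v)

theorem summable_mul_normSqProj (α : ℝ) (v : H) : Summable fun p => α * normSqProj p v :=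
  (hasSum_normSqProj v).summable.mul_left α

theorem givenByProducts_countedSpectrum (α : ℝ) (v : H) :
    GivenByProducts (countedSpectrum (L α v)) fun p => α * normSqProj p v :=
  givenByProducts_of_lost_gained (summable_mul_normSqProj α v) (mul_normSqProj_sign α v)
    mem_lost_countedSpectrum_iff mem_gained_countedSpectrum_iff

theorem exists_normSqProj_ne_zero {v : H} (hv : v ≠ 0) : ∃ p, normSqProj p v ≠ 0 := by
  by_contra! h
  exact hv (eq_of_proj_eq fun p => by rw [normSqProj_eq_zero_iff.1 (h p), map_zero])

/-- The two orderings exclude each other, so the forward implications for both signs already give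
the equivalences. -/
theorem sign_iff {α : ℝ} {v : H} (hα : α ≠ 0) (hv : v ≠ 0) :
    (0 < α ↔ ∃ a ∈ lost (countedSpectrum (L α v)),
        ∀ m ∈ gained (countedSpectrum (L α v)), a < m) ∧
      (α < 0 ↔ ∃ m ∈ gained (countedSpectrum (L α v)),
        ∀ a ∈ lost (countedSpectrum (L α v)), m < a) := by
  have hne : ∃ p, α * normSqProj p v ≠ 0 :=
    (exists_normSqProj_ne_zero hv).imp fun p hp => mul_ne_zero hα hp
  have hpos : 0 < α → ∃ a ∈ lost (countedSpectrum (L α v)),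
      ∀ m ∈ gained (countedSpectrum (L α v)), a < m := fun h =>
    exists_lost_lt_gained (summable_mul_normSqProj α v)
      (fun p => mul_nonneg h.le (normSqProj_nonneg p v)) hne
      mem_lost_countedSpectrum_iff mem_gained_countedSpectrum_iff
  have hneg : α < 0 → ∃ m ∈ gained (countedSpectrum (L α v)),
      ∀ a ∈ lost (countedSpectrum (L α v)), m < a := fun h =>
    exists_gained_lt_lost (summable_mul_normSqProj α v)
      (fun p => mul_nonpos_of_nonpos_of_nonneg h.le (normSqProj_nonneg p v)) hne
      mem_lost_countedSpectrum_iff mem_gained_countedSpectrum_iff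
  have hexcl : (∃ a ∈ lost (countedSpectrum (L α v)),
      ∀ m ∈ gained (countedSpectrum (L α v)), a < m) →
      (∃ m ∈ gained (countedSpectrum (L α v)),
      ∀ a ∈ lost (countedSpectrum (L α v)), m < a) → False := by
    rintro ⟨a, ha, ha'⟩ ⟨m, hm, hm'⟩
    exact lt_asymm (ha' m hm) (hm' a ha)
  refine ⟨⟨hpos, fun h => ?_⟩, ⟨hneg, fun h => ?_⟩⟩
  · by_contra hcon
    exact hexcl h (hneg (lt_of_le_of_ne (not_lt.1 hcon) hα))
  · by_contra hcon
    exact hexcl (hpos (lt_of_le_of_ne (not_lt.1 hcon) hα.symm)) h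

/-! ### Fourier coefficients of the two shifts -/

theorem hasDerivAt_sub_half_pi (x : ℝ) : HasDerivAt (fun y : ℝ => y - Real.pi / 2) 1 x :=
  (hasDerivAt_id' x).sub_const _

theorem hasDerivAt_sin_two_mul (k : ℕ) (x : ℝ) :
    HasDerivAt (fun y : ℝ => Real.sin (2 * k * y)) (Real.cos (2 * k * x) * (2 * k)) x :=
  (hasDerivAt_two_mul k x).sin

theorem hasDerivAt_cos_two_mul (k : ℕ) (x : ℝ) :
    HasDerivAt (fun y : ℝ => Real.cos (2 * k * y)) (-Real.sin (2 * k * x) * (2 * k)) x :=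
  (hasDerivAt_two_mul k x).cos

theorem integral_sin_mul_linear {k : ℕ} (hk : k ≠ 0) :
    ∫ x in (0 : ℝ)..Real.pi, Real.sin (2 * k * x) * (x - Real.pi / 2) = -(Real.pi / (2 * k)) := by
  have hk' : (k : ℝ) ≠ 0 := by exact_mod_cast hk
  have hd : ∀ x ∈ Set.uIcc 0 Real.pi, HasDerivAt (fun y : ℝ =>
      -((y - Real.pi / 2) * Real.cos (2 * k * y)) / (2 * k) + Real.sin (2 * k * y) / (2 * k) ^ 2)
      (Real.sin (2 * k * x) * (x - Real.pi / 2)) x := fun x _ =>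
    ((((hasDerivAt_sub_half_pi x).mul (hasDerivAt_cos_two_mul k x)).neg.div_const _).add
      ((hasDerivAt_sin_two_mul k x).div_const _)).congr_deriv (by field_simp; ring)
  rw [intervalIntegral.integral_eq_sub_of_hasDerivAt hd
    (Continuous.intervalIntegrable (by fun_prop) _ _), sin_two_mul_nat_mul_pi,
    cos_two_mul_nat_mul_pi, mul_zero (2 * (k : ℝ)), Real.sin_zero, Real.cos_zero]
  field_simp
  ring

theorem integral_cos_mul_linear (k : ℕ) :
    ∫ x in (0 : ℝ)..Real.pi, Real.cos (2 * k * x) * (x - Real.pi / 2) = 0 := by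
  rcases eq_or_ne k 0 with rfl | hk
  · have hd : ∀ x ∈ Set.uIcc 0 Real.pi, HasDerivAt (fun y : ℝ => (y - Real.pi / 2) ^ 2 / 2)
        (Real.cos (2 * (0 : ℕ) * x) * (x - Real.pi / 2)) x := fun x _ =>
      (((hasDerivAt_sub_half_pi x).pow 2).div_const _).congr_deriv (by norm_num)
    rw [intervalIntegral.integral_eq_sub_of_hasDerivAt hd
      (Continuous.intervalIntegrable (by fun_prop) _ _)]
    ring
  have hk' : (k : ℝ) ≠ 0 := by exact_mod_cast hk
  have hd : ∀ x ∈ Set.uIcc 0 Real.pi, HasDerivAt (fun y : ℝ =>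
      ((y - Real.pi / 2) * Real.sin (2 * k * y)) / (2 * k) + Real.cos (2 * k * y) / (2 * k) ^ 2)
      (Real.cos (2 * k * x) * (x - Real.pi / 2)) x := fun x _ =>
    ((((hasDerivAt_sub_half_pi x).mul (hasDerivAt_sin_two_mul k x)).div_const _).add
      ((hasDerivAt_cos_two_mul k x).div_const _)).congr_deriv (by field_simp; ring)
  rw [intervalIntegral.integral_eq_sub_of_hasDerivAt hd
    (Continuous.intervalIntegrable (by fun_prop) _ _), sin_two_mul_nat_mul_pi,
    cos_two_mul_nat_mul_pi, mul_zero (2 * (k : ℝ)), Real.sin_zero, Real.cos_zero]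
  ring

theorem integral_cos_mul_quadratic {k : ℕ} (hk : k ≠ 0) :
    ∫ x in (0 : ℝ)..Real.pi, Real.cos (2 * k * x) * (x - Real.pi / 2) ^ 2 =
      Real.pi / (2 * k ^ 2) := by
  have hk' : (k : ℝ) ≠ 0 := by exact_mod_cast hk
  have hd : ∀ x ∈ Set.uIcc 0 Real.pi, HasDerivAt (fun y : ℝ =>
      ((y - Real.pi / 2) ^ 2 * Real.sin (2 * k * y)) / (2 * k) +
        (2 * ((y - Real.pi / 2) * Real.cos (2 * k * y))) / (2 * k) ^ 2 +
          (-2 * Real.sin (2 * k * y)) / (2 * k) ^ 3)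
      (Real.cos (2 * k * x) * (x - Real.pi / 2) ^ 2) x := fun x _ =>
    ((((((hasDerivAt_sub_half_pi x).pow 2).mul (hasDerivAt_sin_two_mul k x)).div_const _).add
      ((((hasDerivAt_sub_half_pi x).mul (hasDerivAt_cos_two_mul k x)).const_mul 2).div_const _)).add
      (((hasDerivAt_sin_two_mul k x).const_mul (-2)).div_const _)).congr_deriv (by
        norm_num; field_simp; ring)
  rw [intervalIntegral.integral_eq_sub_of_hasDerivAt hd
    (Continuous.intervalIntegrable (by fun_prop) _ _), sin_two_mul_nat_mul_pi,
    cos_two_mul_nat_mul_pi, mul_zero (2 * (k : ℝ)), Real.sin_zero, Real.cos_zero]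
  field_simp
  ring

theorem integral_quadratic :
    ∫ x in (0 : ℝ)..Real.pi, (x - Real.pi / 2) ^ 2 = Real.pi ^ 3 / 12 := by
  have hd : ∀ x ∈ Set.uIcc 0 Real.pi, HasDerivAt (fun y : ℝ => (y - Real.pi / 2) ^ 3 / 3)
      ((x - Real.pi / 2) ^ 2) x := fun x _ =>
    (((hasDerivAt_sub_half_pi x).pow 3).div_const _).congr_deriv (by norm_num)
  rw [intervalIntegral.integral_eq_sub_of_hasDerivAt hd
    (Continuous.intervalIntegrable (by fun_prop) _ _)]
  ring

theorem integral_sin_mul_quadratic (k : ℕ) :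
    ∫ x in (0 : ℝ)..Real.pi, Real.sin (2 * k * x) * (x - Real.pi / 2) ^ 2 = 0 := by
  rcases eq_or_ne k 0 with rfl | hk
  · simp
  have hk' : (k : ℝ) ≠ 0 := by exact_mod_cast hk
  have hd : ∀ x ∈ Set.uIcc 0 Real.pi, HasDerivAt (fun y : ℝ =>
      -((y - Real.pi / 2) ^ 2 * Real.cos (2 * k * y)) / (2 * k) +
        (2 * ((y - Real.pi / 2) * Real.sin (2 * k * y))) / (2 * k) ^ 2 +
          (2 * Real.cos (2 * k * y)) / (2 * k) ^ 3)
      (Real.sin (2 * k * x) * (x - Real.pi / 2) ^ 2) x := fun x _ =>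
    ((((((hasDerivAt_sub_half_pi x).pow 2).mul (hasDerivAt_cos_two_mul k x)).neg.div_const _).add
      ((((hasDerivAt_sub_half_pi x).mul (hasDerivAt_sin_two_mul k x)).const_mul 2).div_const _)).add
      (((hasDerivAt_cos_two_mul k x).const_mul 2).div_const _)).congr_deriv (by
        norm_num; field_simp; ring)
  rw [intervalIntegral.integral_eq_sub_of_hasDerivAt hd
    (Continuous.intervalIntegrable (by fun_prop) _ _), sin_two_mul_nat_mul_pi,
    cos_two_mul_nat_mul_pi, mul_zero (2 * (k : ℝ)), Real.sin_zero, Real.cos_zero]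
  ring

theorem c_ofContinuous (k : ℕ) (g : ℝ → ℝ) (hg : Continuous fun x => (g x : ℂ)) :
    c k (ofContinuous (fun x => (g x : ℂ)) hg) =
      ((amp k * ∫ x in (0 : ℝ)..Real.pi, Real.cos (2 * k * x) * g x : ℝ) : ℂ) := by
  rw [c, cosVec, inner_ofContinuous_ofContinuous]
  simp only [cosVec_apply_eq]
  simp only [mul_assoc, intervalIntegral.integral_const_mul]

theorem s_ofContinuous (k : ℕ) (g : ℝ → ℝ) (hg : Continuous fun x => (g x : ℂ)) :
    s k (ofContinuous (fun x => (g x : ℂ)) hg) =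
      ((√(2 / Real.pi) * ∫ x in (0 : ℝ)..Real.pi, Real.sin (2 * k * x) * g x : ℝ) : ℂ) := by
  rw [s, sinVec, inner_ofContinuous_ofContinuous]
  simp only [mul_assoc, intervalIntegral.integral_const_mul]

theorem sqrt_two_div_pi : √(2 / Real.pi) = √(2 * Real.pi) / Real.pi := by
  have hpi := Real.pi_pos
  rw [show 2 / Real.pi = 2 * Real.pi / Real.pi ^ 2 by field_simp, Real.sqrt_div (by positivity),
    Real.sqrt_sq hpi.le]

theorem c_oddShift (k : ℕ) (v : H) : c k (oddShift v) = c k v := by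
  rw [oddShift, c_add, c_ofContinuous, integral_cos_mul_linear, mul_zero, Complex.ofReal_zero,
    add_zero]

theorem s_oddShift {k : ℕ} (hk : k ≠ 0) (v : H) :
    s k (oddShift v) = s k v + ((-(√(2 * Real.pi) / (2 * k)) : ℝ) : ℂ) := by
  rw [oddShift, s_add, s_ofContinuous, integral_sin_mul_linear hk, sqrt_two_div_pi]
  congr 2
  have := Real.pi_ne_zero
  have hk' : (k : ℝ) ≠ 0 := by exact_mod_cast hk
  field_simp

theorem s_evenShift (k : ℕ) (v : H) : s k (evenShift v) = s k v := by
  rw [evenShift, s_add, s_ofContinuous, integral_sin_mul_quadratic, mul_zero, Complex.ofReal_zero,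
    add_zero]

theorem c_evenShift {k : ℕ} (hk : k ≠ 0) (v : H) :
    c k (evenShift v) = c k v + ((√(2 * Real.pi) / (2 * k ^ 2) : ℝ) : ℂ) := by
  rw [evenShift, c_add, c_ofContinuous, integral_cos_mul_quadratic hk, amp, if_neg hk,
    sqrt_two_div_pi]
  congr 2
  have := Real.pi_ne_zero
  have hk' : (k : ℝ) ≠ 0 := by exact_mod_cast hk
  field_simp

theorem c_zero_evenShift (v : H) :
    c 0 (evenShift v) = c 0 v + ((√Real.pi ^ 5 / 12 : ℝ) : ℂ) := by
  rw [evenShift, c_add, c_ofContinuous, amp, if_pos rfl]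
  simp only [Nat.cast_zero, mul_zero, zero_mul, Real.cos_zero, one_mul]
  rw [integral_quadratic]
  congr 2
  have h := Real.sq_sqrt Real.pi_pos.le
  have h0 : √Real.pi ≠ 0 := (Real.sqrt_pos.2 Real.pi_pos).ne'
  -- Writes π³ as (√π)⁶, so that the factor 1/√π leaves (√π)⁵.
  nth_rewrite 2 [← h]
  field_simp

/-! ### Recovery of the coefficients and uniqueness -/

theorem exists_ofReal_integral {v : H} (hv : IsReal v) (f : ℝ → ℝ) :
    ∃ a : ℝ, ∫ x in (0 : ℝ)..Real.pi, (f x : ℂ) * v x = a := by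
  refine ⟨∫ x in (0 : ℝ)..Real.pi, f x * (v x).re, ?_⟩
  rw [← intervalIntegral.integral_ofReal]
  refine integral_congr_mu ?_ pi_mem_Icc
  filter_upwards [hv] with x hx
  rw [Complex.ofReal_mul]
  congr 1
  exact Complex.ext rfl hx

theorem exists_real_coeff {v : H} (hv : IsReal v) (k : ℕ) :
    ∃ a b : ℝ, c k v = a ∧ s k v = b := by
  obtain ⟨a, ha⟩ := exists_ofReal_integral hv fun x => amp k * Real.cos (2 * k * x)
  obtain ⟨b, hb⟩ := exists_ofReal_integral hv fun x => √(2 / Real.pi) * Real.sin (2 * k * x)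
  exact ⟨a, b, (c_eq_integral k v).trans ha, (s_eq_integral k v).trans hb⟩

theorem normSqProj_of_real {k : ℕ} {v : H} {a b : ℝ} (ha : c k v = a) (hb : s k v = b) :
    normSqProj k v = a ^ 2 + b ^ 2 := by
  rw [normSqProj_eq, ha, hb, Complex.norm_real, Complex.norm_real, Real.norm_eq_abs,
    Real.norm_eq_abs, sq_abs, sq_abs]

/-- Only the sine coefficient b moves, by -d with d = √(2π)/(2k), and b² - (b - d)² = 2bd - d² with
d² = π/(2k²) is solved for b. Realness of v makes the squared norms plain squares. -/
theorem mul_s_eq (α : ℝ) {v : H} (hv : IsReal v) {k : ℕ} (hk : 1 ≤ k) :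
    (α : ℂ) * s k v = (((k : ℝ) / √(2 * Real.pi) *
      (α * normSqProj k v - α * normSqProj k (oddShift v)
        + α * (Real.pi / (2 * (k : ℝ) ^ 2))) : ℝ) : ℂ) := by
  have hk0 : k ≠ 0 := by omega
  have hk' : (k : ℝ) ≠ 0 := by exact_mod_cast hk0
  obtain ⟨a, b, ha, hb⟩ := exists_real_coeff hv k
  have hs := s_oddShift hk0 v
  rw [hb, ← Complex.ofReal_add] at hs
  rw [normSqProj_of_real ha hb, normSqProj_of_real ((c_oddShift k v).trans ha) hs, hb,
    ← Complex.ofReal_mul]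
  congr 1
  have hpi := Real.pi_pos
  have hr : √(2 * Real.pi) ≠ 0 := by positivity
  have hr2 : √(2 * Real.pi) ^ 2 = 2 * Real.pi := Real.sq_sqrt (by positivity)
  field_simp
  linear_combination α * hr2

/-- Here the cosine coefficient moves by d = √(2π)/(2k²), with d² = π/(2k⁴). -/
theorem mul_c_eq (α : ℝ) {v : H} (hv : IsReal v) {k : ℕ} (hk : 1 ≤ k) :
    (α : ℂ) * c k v = (((k : ℝ) ^ 2 / √(2 * Real.pi) *
      (α * normSqProj k (evenShift v) - α * normSqProj k v
        - α * (Real.pi / (2 * (k : ℝ) ^ 4))) : ℝ) : ℂ) := by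
  have hk0 : k ≠ 0 := by omega
  have hk' : (k : ℝ) ≠ 0 := by exact_mod_cast hk0
  obtain ⟨a, b, ha, hb⟩ := exists_real_coeff hv k
  have hs := c_evenShift hk0 v
  rw [ha, ← Complex.ofReal_add] at hs
  rw [normSqProj_of_real ha hb, normSqProj_of_real hs ((s_evenShift k v).trans hb), ha,
    ← Complex.ofReal_mul]
  congr 1
  have hpi := Real.pi_pos
  have hr : √(2 * Real.pi) ≠ 0 := by positivity
  have hr2 : √(2 * Real.pi) ^ 2 = 2 * Real.pi := Real.sq_sqrt (by positivity)
  field_simp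
  linear_combination (-α) * hr2

/-- The constant mode moves by d = π^{5/2}/12, whence 1/(2d) = 6/π^{5/2} and d² = π⁵/144. -/
theorem mul_c_zero_eq (α : ℝ) {v : H} (hv : IsReal v) :
    (α : ℂ) * c 0 v = ((6 / Real.pi ^ ((5 : ℝ) / 2) *
      (α * normSqProj 0 (evenShift v) - α * normSqProj 0 v
        - α * (Real.pi ^ 5 / 144)) : ℝ) : ℂ) := by
  obtain ⟨a, b, ha, hb⟩ := exists_real_coeff hv 0
  have hs := c_zero_evenShift v
  rw [ha, ← Complex.ofReal_add] at hs
  rw [normSqProj_of_real ha hb, normSqProj_of_real hs ((s_evenShift 0 v).trans hb), ha,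
    ← Complex.ofReal_mul]
  congr 1
  have hp : Real.pi ^ ((5 : ℝ) / 2) = √Real.pi ^ 5 := by
    rw [Real.sqrt_eq_rpow, ← Real.rpow_natCast, ← Real.rpow_mul Real.pi_pos.le]
    norm_num
  have h := Real.sq_sqrt Real.pi_pos.le
  have h0 : √Real.pi ≠ 0 := (Real.sqrt_pos.2 Real.pi_pos).ne'
  have h5 : Real.pi ^ 5 = √Real.pi ^ 10 := by
    nth_rewrite 1 [← h]
    ring
  rw [hp, h5]
  field_simp
  ring

theorem hasSum_sq_coeff (α : ℝ) {v : H} (hv : IsReal v) (h1 : ‖v‖ = 1) :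
    HasSum (fun k => ((α : ℂ) * c k v) ^ 2 + ((α : ℂ) * s k v) ^ 2) ((α : ℂ) ^ 2) := by
  have h := (hasSum_normSqProj v).mul_left (α ^ 2)
  rw [h1, one_pow, mul_one] at h
  have h' := Complex.hasSum_ofReal.2 h
  rw [Complex.ofReal_pow] at h'
  refine h'.congr_fun fun k => ?_
  obtain ⟨a, b, ha, hb⟩ := exists_real_coeff hv k
  rw [normSqProj_of_real ha hb, ha, hb]
  push_cast
  ring

theorem hasSum_mul_normSqProj (α : ℝ) {v : H} (h1 : ‖v‖ = 1) :
    HasSum (fun p => α * normSqProj p v) α := by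
  simpa [h1] using (hasSum_normSqProj v).mul_left α

theorem mul_normSqProj_eq_of_countedSpectrum_eq {α α' : ℝ} {v v' : H}
    (h : countedSpectrum (L α v) = countedSpectrum (L α' v')) (p : ℕ) :
    α * normSqProj p v = α' * normSqProj p v' := by
  have h' := givenByProducts_countedSpectrum α' v'
  rw [← h] at h'
  exact congrFun ((givenByProducts_countedSpectrum α v).unique h') p

/-- The spectra of two perturbations by `v` and by `oddShift v` separate the signs of `α`. -/
theorem ne_neg_of_mul_normSqProj_eq {α α' : ℝ} {v v' : H} (hv : IsReal v) (hα : α ≠ 0)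
    (h1 : α * normSqProj 1 v = α' * normSqProj 1 v')
    (h2 : α * normSqProj 1 (oddShift v) = α' * normSqProj 1 (oddShift v')) : α ≠ -α' := by
  intro h
  -- With α' = -α the equality reads x = -y for nonnegative numbers, so both vanish. But v₁ and w₁
  -- cannot both vanish, since x - π/2 has a nonzero first sine coefficient.
  have key : ∀ {x y : ℝ}, 0 ≤ x → 0 ≤ y → α * x = α' * y → x = 0 := by
    intro x y hx hy hxy
    have : α * (x + y) = 0 := by rw [mul_add, hxy, h]; ring
    linarith [(mul_eq_zero.1 this).resolve_left hα]
  have e1 := key (normSqProj_nonneg _ _) (normSqProj_nonneg _ _) h1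
  have e2 := key (normSqProj_nonneg _ _) (normSqProj_nonneg _ _) h2
  have hs := mul_s_eq α hv (le_refl 1)
  have hs0 : s 1 v = 0 := by
    rw [normSqProj_eq] at e1
    have : ‖s 1 v‖ ^ 2 = 0 := by linarith [sq_nonneg ‖c 1 v‖, sq_nonneg ‖s 1 v‖]
    simpa using this
  rw [e1, e2, hs0, mul_zero] at hs
  have hs' := (Complex.ofReal_eq_zero.1 hs.symm)
  have hpi := Real.pi_pos
  -- The term that survives in the formula for α s₁ when both norms and s₁ are zero.
  have hne : (1 : ℝ) / √(2 * Real.pi) * (α * (Real.pi / (2 * 1 ^ 2))) ≠ 0 := by positivity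
  exact hne (by simpa using hs')

theorem eq_of_mul_coeff_eq {α : ℝ} {v v' : H} (hα : α ≠ 0)
    (h : ∀ k : ℕ, (α : ℂ) * s k v = (α : ℂ) * s k v' ∧ (α : ℂ) * c k v = (α : ℂ) * c k v') :
    v = v' := by
  have hα' : (α : ℂ) ≠ 0 := by exact_mod_cast hα
  rw [← sub_eq_zero]
  refine eq_zero_of_coeff_eq_zero (fun k => ?_) fun k => ?_
  · rw [c_sub, mul_left_cancel₀ hα' (h k).2, sub_self]
  · rw [s_sub, mul_left_cancel₀ hα' (h k).1, sub_self]

theorem coeff_unique {α α' : ℝ} {v v' : H} (hv : IsReal v) (hv' : IsReal v')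
    (hnorm : (‖v‖ = 1 ∧ ‖v'‖ = 1) ∨ (|α| = 1 ∧ |α'| = 1))
    (h : countedSpectrum (L α v) = countedSpectrum (L α' v'))
    (ho : countedSpectrum (L α (oddShift v)) = countedSpectrum (L α' (oddShift v')))
    (he : countedSpectrum (L α (evenShift v)) = countedSpectrum (L α' (evenShift v'))) :
    (∀ k : ℕ, (α : ℂ) * s k v = (α' : ℂ) * s k v' ∧ (α : ℂ) * c k v = (α' : ℂ) * c k v') ∧
      α = α' ∧ (α ≠ 0 → v = v') := by
  have e := mul_normSqProj_eq_of_countedSpectrum_eq h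
  have eo := mul_normSqProj_eq_of_countedSpectrum_eq ho
  have ee := mul_normSqProj_eq_of_countedSpectrum_eq he
  have hα : α = α' := by
    rcases hnorm with ⟨h1, h2⟩ | ⟨h1, h2⟩
    · have h3 := hasSum_mul_normSqProj α h1
      simp only [e] at h3
      exact h3.unique (hasSum_mul_normSqProj α' h2)
    · have hα0 : α ≠ 0 := fun h0 => by simp [h0] at h1
      exact (abs_eq_abs.1 (h1.trans h2.symm)).resolve_right
        (ne_neg_of_mul_normSqProj_eq hv hα0 (e 1) (eo 1))
  have hcoeff : ∀ k : ℕ,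
      (α : ℂ) * s k v = (α' : ℂ) * s k v' ∧ (α : ℂ) * c k v = (α' : ℂ) * c k v' := by
    intro k
    rcases Nat.eq_zero_or_pos k with rfl | hk
    · refine ⟨by rw [s_zero_index, s_zero_index, mul_zero, mul_zero], ?_⟩
      rw [mul_c_zero_eq α hv, mul_c_zero_eq α' hv', e, ee, hα]
    · refine ⟨?_, ?_⟩
      · rw [mul_s_eq α hv hk, mul_s_eq α' hv' hk, e, eo, hα]
      · rw [mul_c_eq α hv hk, mul_c_eq α' hv' hk, e, ee, hα]
  refine ⟨hcoeff, hα, fun hα0 => eq_of_mul_coeff_eq hα0 ?_⟩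
  rw [← hα] at hcoeff
  exact hcoeff

end NonlocalPeriodic

end

open NonlocalPeriodic in
theorem theorem4p2 (α : ℝ) (v : H) (hv : IsReal v) :
    -- the numbers `α‖v_p‖²`, `α‖w_p‖²`, `α‖ŵ_p‖²` are computed from the three spectra
    (GivenByProducts (countedSpectrum (L α v)) (fun p => α * normSqProj p v) ∧
      GivenByProducts (countedSpectrum (L α (oddShift v)))
        (fun p => α * normSqProj p (oddShift v)) ∧
      GivenByProducts (countedSpectrum (L α (evenShift v)))
        (fun p => α * normSqProj p (evenShift v))) ∧
    -- the numbers `α s_k(v)` and `α c_k(v)` are computed from these numbers and `α`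
    ((∀ k : ℕ, 1 ≤ k →
        (α : ℂ) * s k v = (((k : ℝ) / √(2 * Real.pi) *
          (α * normSqProj k v - α * normSqProj k (oddShift v)
            + α * (Real.pi / (2 * (k : ℝ) ^ 2))) : ℝ) : ℂ)) ∧
      (∀ k : ℕ, 1 ≤ k →
        (α : ℂ) * c k v = (((k : ℝ) ^ 2 / √(2 * Real.pi) *
          (α * normSqProj k (evenShift v) - α * normSqProj k v
            - α * (Real.pi / (2 * (k : ℝ) ^ 4))) : ℝ) : ℂ)) ∧
      (α : ℂ) * c 0 v = ((6 / Real.pi ^ ((5 : ℝ) / 2) *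
          (α * normSqProj 0 (evenShift v) - α * normSqProj 0 v
            - α * (Real.pi ^ 5 / 144)) : ℝ) : ℂ)) ∧
    -- under the normalization `‖v‖ = 1` the number `α` is computed as well
    (‖v‖ = 1 →
      HasSum (fun p => α * normSqProj p v) α ∧
      HasSum (fun k => ((α : ℂ) * c k v) ^ 2 + ((α : ℂ) * s k v) ^ 2) ((α : ℂ) ^ 2)) ∧
    -- the sign of `α` is read off from the interlacing of the two sets of points
    (α ≠ 0 → v ≠ 0 →
      (0 < α ↔ ∃ a ∈ lost (countedSpectrum (L α v)),
        ∀ m ∈ gained (countedSpectrum (L α v)), a < m) ∧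
      (α < 0 ↔ ∃ m ∈ gained (countedSpectrum (L α v)),
        ∀ a ∈ lost (countedSpectrum (L α v)), m < a)) ∧
    -- uniqueness
    (∀ (α' : ℝ) (v' : H), IsReal v' →
      ((‖v‖ = 1 ∧ ‖v'‖ = 1) ∨ (|α| = 1 ∧ |α'| = 1)) →
      countedSpectrum (L α v) = countedSpectrum (L α' v') →
      countedSpectrum (L α (oddShift v)) = countedSpectrum (L α' (oddShift v')) →
      countedSpectrum (L α (evenShift v)) = countedSpectrum (L α' (evenShift v')) →
      (∀ k : ℕ, (α : ℂ) * s k v = (α' : ℂ) * s k v' ∧ (α : ℂ) * c k v = (α' : ℂ) * c k v') ∧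
      α = α' ∧ (α ≠ 0 → v = v')) := by
  exact ⟨⟨givenByProducts_countedSpectrum α v, givenByProducts_countedSpectrum α (oddShift v),
      givenByProducts_countedSpectrum α (evenShift v)⟩,
    ⟨fun _ hk => mul_s_eq α hv hk, fun _ hk => mul_c_eq α hv hk, mul_c_zero_eq α hv⟩,
    fun h1 => ⟨hasSum_mul_normSqProj α h1, hasSum_sq_coeff α hv h1⟩,
    fun hα hv0 => sign_iff hα hv0,
    fun _ _ hv' hnorm h ho he => coeff_unique hv hv' hnorm h ho he⟩
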